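/- Let $\mathcal E$ be an elementary topos and $R$ an ordered commutative ring object of $\mathcal E$: a commutative ring object with a subobject ${\le}\rightarrowtail R\times R$ that satisfies, in the internal language, the axioms of a total order ($\forall i,j:R.\ i\le j\vee j\le i$, together with reflexivity, transitivity and antisymmetry), $i\le j\Rightarrow k+i\le k+j$, and $0\le i\wedge 0\le j\Rightarrow 0\le i\cdot j$. Put $R_+=\{i:R\mid 0\le i\}$. For $x,y:\Gamma$ the object of Moore paths is $$x\sim y=\{(f,i):(R_+\to\Gamma)\times R_+\mid f\,0=x\ \wedge\ \forall j\ge i.\ f\,j=y\}.$$ For $p=(f,i)$ write $p\,j=f\,j$, and let $|p|=i$ be its shape; the degenerate path $\mathrm{idp}\,x:x\sim x$ is constant with shape $0$; $\gamma\,{}'(f,i)=(\gamma\circ f,i)$ is the image of a path under a morphism $\gamma$. Regard $\mathcal E$ as a category with families (CwF) through its local universes: a family $A\in\mathcal E(\Gamma)$ is a morphism $E\to V$ with a morphism $\Gamma\to V$, it is re-indexed by composition, $\Gamma.A$ is the pullback, and the elements $\mathcal E(\Gamma\vdash A)$ are the lifts of $\Gamma\to V$ to $E$ (equivalently, the sections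 of $\mathsf{fst}:\Gamma.A\to\Gamma$). A transport-along-paths (tap) structure on $A\in\mathcal E(\Gamma)$ is, in the internal language, a family of functions $p_*:A\,x\to A\,y$ for $x,y:\Gamma$ and $p:x\sim y$, with $(\mathrm{idp}\,x)_*a=a$; it is re-indexed along $\gamma:\Delta\to\Gamma$ by letting $p$ act as $(\gamma\,{}'p)_*$. Let $\mathbf{Fib}$ be the CwF on $\mathcal E$ whose families over $\Gamma$ are the families in $\mathcal E(\Gamma)$ with a tap structure, and whose elements are those of the underlying families. For $A\in\mathbf{Fib}(\Gamma)$ let $\mathrm{Id}_A=(a_1\sim a_2\mid((x,a_1),a_2):\Gamma.A.A\,\mathsf{fst})\in\mathcal E(\Gamma.A.A\,\mathsf{fst})$ be the family of objects of Moore paths in the fibres $A\,x$. Then one can give, for all $\Gamma$ and all $A\in\mathbf{Fib}(\Gamma)$, the following data, all of it stable under re-indexing along every $\gamma:\Delta\to\Gamma$: 1. a tap structure on $\mathrm{Id}_A$, so that $\mathrm{Id}_A\in\mathbf{Fib}(\Gamma.A.A\,\mathsf{fst})$; 2. a morphism $\mathrm{refl}_A:\Gamma.A\to\Gamma.A.A\,\mathsf{fst}.\mathrm{Id}_A$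 whose composite with the projection to $\Gamma.A.A\,\mathsf{fst}$ is the diagonal $\langle\mathrm{id},\mathsf{snd}\rangle$; it is given by degenerate paths, $\mathrm{refl}_A(x,a)=(((x,a),a),\mathrm{idp}\,a)$; 3. a function sending each $B\in\mathbf{Fib}(\Gamma.A.A\,\mathsf{fst}.\mathrm{Id}_A)$ and $\beta\in\mathbf{Fib}(\Gamma.A\vdash B\,\mathrm{refl}_A)$ to an element $\mathrm J_A\,B\,\beta\in\mathbf{Fib}(\Gamma.A.A\,\mathsf{fst}.\mathrm{Id}_A\vdash B)$ with $(\mathrm J_A\,B\,\beta)\,\mathrm{refl}_A=\beta$ (an equality of elements); it is given by $\mathrm J_A\,B\,\beta\,(((x,a_1),a_2),p)=c_*\,\beta(x,a_1)$, where $c:(((x,a_1),a_1),\mathrm{idp}\,a_1)\sim(((x,a_1),a_2),p)$ is the contraction path of shape $|p|$ whose value at $i\le|p|$ is $(((x,a_1),p\,i),q_i)$, with $q_i:a_1\sim p\,i$ the path of shape $i$ that agrees with $p$ up to $i$. That is, $\mathbf{Fib}$ supports the interpretation of intensional identity types in Hofmann's sense, given by Moore path objects. -/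

import Mathlib

open CategoryTheory MonoidalCategory CartesianMonoidalCategory Limits
open scoped CommRingObj

universe v u w

namespace MooreTT

noncomputable section

/-! ### Categories with families and intensional identity types -/

/-- A category with families on a category `C`. The functor from `Cᵒᵖ` to families of sets,
`Γ ↦ (K(Γ ⊢ A))_{A : K(Γ)}`, is presented by the presheaf `Ty` of families, the presheaf `Tm` of
all elements of all families, and the natural map `typ` sending an element to the family it
belongs to; so `K(Γ ⊢ A)` is the fibre of `typ` over `A` (see `CwF.El`). -/
structure CwF (C : Type u) [Category.{v} C] where
  /-- the empty context -/
  emp : C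
  empIsTerminal : IsTerminal emp
  /-- families over `Γ` -/
  Ty : C → Type w
  /-- elements of families over `Γ` -/
  Tm : C → Type w
  typ : ∀ {Γ : C}, Tm Γ → Ty Γ
  /-- re-indexing of families -/
  tySub : ∀ {Δ Γ : C}, (Δ ⟶ Γ) → Ty Γ → Ty Δ
  /-- re-indexing of elements -/
  tmSub : ∀ {Δ Γ : C}, (Δ ⟶ Γ) → Tm Γ → Tm Δ
  typ_tmSub : ∀ {Δ Γ : C} (σ : Δ ⟶ Γ) (a : Tm Γ), typ (tmSub σ a) = tySub σ (typ a)
  tySub_id : ∀ {Γ : C} (A : Ty Γ), tySub (𝟙 Γ) A = A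
  tySub_comp : ∀ {Θ Δ Γ : C} (τ : Θ ⟶ Δ) (σ : Δ ⟶ Γ) (A : Ty Γ),
    tySub (τ ≫ σ) A = tySub τ (tySub σ A)
  tmSub_id : ∀ {Γ : C} (a : Tm Γ), tmSub (𝟙 Γ) a = a
  tmSub_comp : ∀ {Θ Δ Γ : C} (τ : Θ ⟶ Δ) (σ : Δ ⟶ Γ) (a : Tm Γ),
    tmSub (τ ≫ σ) a = tmSub τ (tmSub σ a)
  /-- the comprehension object `Γ.A` -/
  ext : ∀ {Γ : C}, Ty Γ → C
  /-- the projection `Γ.A ⟶ Γ` -/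
  p : ∀ {Γ : C} (A : Ty Γ), ext A ⟶ Γ
  /-- the generic element of `A` re-indexed along the projection -/
  q : ∀ {Γ : C} (A : Ty Γ), Tm (ext A)
  typ_q : ∀ {Γ : C} (A : Ty Γ), typ (q A) = tySub (p A) A
  /-- the pairing `⟨σ, a⟩ : Δ ⟶ Γ.A` -/
  pair : ∀ {Δ Γ : C} {A : Ty Γ} (σ : Δ ⟶ Γ) (a : Tm Δ), typ a = tySub σ A → (Δ ⟶ ext A)
  pair_p : ∀ {Δ Γ : C} {A : Ty Γ} (σ : Δ ⟶ Γ) (a : Tm Δ) (h : typ a = tySub σ A),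
    pair σ a h ≫ p A = σ
  pair_q : ∀ {Δ Γ : C} {A : Ty Γ} (σ : Δ ⟶ Γ) (a : Tm Δ) (h : typ a = tySub σ A),
    tmSub (pair σ a h) (q A) = a
  hom_ext : ∀ {Δ Γ : C} {A : Ty Γ} (f g : Δ ⟶ ext A),
    f ≫ p A = g ≫ p A → tmSub f (q A) = tmSub g (q A) → f = g

namespace CwF

variable {C : Type u} [Category.{v} C] (K : CwF.{v, u, w} C)

/-- The set `K(Γ ⊢ A)` of elements of the family `A`. -/
def El {Γ : C} (A : K.Ty Γ) : Type w := {a : K.Tm Γ // K.typ a = A}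

/-- The family `A p` over `Γ.A`, so that `K.ext (K.wk A)` is `Γ.A.A p`. -/
def wk {Γ : C} (A : K.Ty Γ) : K.Ty (K.ext A) := K.tySub (K.p A) A

/-- The diagonal `⟨id, q⟩ : Γ.A ⟶ Γ.A.A p`. -/
def diag {Γ : C} (A : K.Ty Γ) : K.ext A ⟶ K.ext (K.wk A) :=
  K.pair (𝟙 _) (K.q A) (by rw [K.tySub_id, K.typ_q]; rfl)

/-- The morphism `⟨σ p, q⟩ : Δ.B ⟶ Γ.A` induced by `σ : Δ ⟶ Γ`, when `B` is `A σ`. -/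
def lift {Δ Γ : C} (σ : Δ ⟶ Γ) {B : K.Ty Δ} {A : K.Ty Γ} (h : B = K.tySub σ A) :
    K.ext B ⟶ K.ext A :=
  K.pair (K.p B ≫ σ) (K.q B) (by rw [K.typ_q, h, K.tySub_comp])

lemma lift_p {Δ Γ : C} (σ : Δ ⟶ Γ) {B : K.Ty Δ} {A : K.Ty Γ} (h : B = K.tySub σ A) :
    K.lift σ h ≫ K.p A = K.p B ≫ σ := K.pair_p _ _ _

lemma lift_q {Δ Γ : C} (σ : Δ ⟶ Γ) {B : K.Ty Δ} {A : K.Ty Γ} (h : B = K.tySub σ A) :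
    K.tmSub (K.lift σ h) (K.q A) = K.q B := K.pair_q _ _ _

/-- The morphism `γ⁺ : Δ.Aγ ⟶ Γ.A`. -/
def lift₁ {Δ Γ : C} (γ : Δ ⟶ Γ) (A : K.Ty Γ) : K.ext (K.tySub γ A) ⟶ K.ext A :=
  K.lift γ rfl

lemma wk_tySub {Δ Γ : C} (γ : Δ ⟶ Γ) (A : K.Ty Γ) :
    K.wk (K.tySub γ A) = K.tySub (K.lift₁ γ A) (K.wk A) := by
  rw [wk, wk, ← K.tySub_comp, ← K.tySub_comp, lift₁, lift_p]

/-- The morphism `γ⁺⁺ : Δ.Aγ.Aγp ⟶ Γ.A.Ap`. -/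
def lift₂ {Δ Γ : C} (γ : Δ ⟶ Γ) (A : K.Ty Γ) :
    K.ext (K.wk (K.tySub γ A)) ⟶ K.ext (K.wk A) :=
  K.lift (K.lift₁ γ A) (K.wk_tySub γ A)

/-- The structure making the families `Id_A` over `Γ.A.A p` into intensional identity types:
`Id`, `refl` and `J`, the computation rule as an equation between elements, and stability of all
three under re-indexing. -/
structure IdTypes (Id : ∀ (Γ : C) (A : K.Ty Γ), K.Ty (K.ext (K.wk A))) where
  Id_sub : ∀ {Δ Γ : C} (γ : Δ ⟶ Γ) (A : K.Ty Γ),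
    Id Δ (K.tySub γ A) = K.tySub (K.lift₂ γ A) (Id Γ A)
  refl : ∀ {Γ : C} (A : K.Ty Γ), K.ext A ⟶ K.ext (Id Γ A)
  refl_p : ∀ {Γ : C} (A : K.Ty Γ), refl A ≫ K.p (Id Γ A) = K.diag A
  refl_sub : ∀ {Δ Γ : C} (γ : Δ ⟶ Γ) (A : K.Ty Γ),
    refl (K.tySub γ A) ≫ K.lift (K.lift₂ γ A) (Id_sub γ A) = K.lift₁ γ A ≫ refl A
  J : ∀ {Γ : C} (A : K.Ty Γ) (B : K.Ty (K.ext (Id Γ A))), K.El (K.tySub (refl A) B) → K.El B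
  J_refl : ∀ {Γ : C} (A : K.Ty Γ) (B : K.Ty (K.ext (Id Γ A))) (β : K.El (K.tySub (refl A) B)),
    K.tmSub (refl A) (J A B β).1 = β.1
  J_sub : ∀ {Δ Γ : C} (γ : Δ ⟶ Γ) (A : K.Ty Γ) (B : K.Ty (K.ext (Id Γ A)))
    (β : K.El (K.tySub (refl A) B)),
    (J (K.tySub γ A) (K.tySub (K.lift (K.lift₂ γ A) (Id_sub γ A)) B)
      ⟨K.tmSub (K.lift₁ γ A) β.1, by
        rw [K.typ_tmSub, β.2, ← K.tySub_comp, ← K.tySub_comp, refl_sub]⟩).1 =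
      K.tmSub (K.lift (K.lift₂ γ A) (Id_sub γ A)) (J A B β).1

end CwF

/-! ### The category with families of a category with pullbacks -/

section Families

variable {C : Type u} [Category.{v} C]

/-- A family over `Γ`, in the local universes presentation: a morphism `proj : tot ⟶ base`
together with a morphism `name : Γ ⟶ base`. It stands for the pullback of `proj` along `name`,
regarded as an object of the slice over `Γ`; its fibre at `x : Γ` is the fibre of `proj` at
`name x`. Keeping the pullback implicit makes re-indexing strictly functorial. -/
structure Fam (Γ : C) where
  base : C
  tot : C
  proj : tot ⟶ base
  name : Γ ⟶ base

/-- Re-indexing of families. -/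
def Fam.sub {Δ Γ : C} (σ : Δ ⟶ Γ) (A : Fam Γ) : Fam Δ where
  base := A.base
  tot := A.tot
  proj := A.proj
  name := σ ≫ A.name

/-- An element of the family `fam` over `Γ`: a morphism to the total object lying over the name
of the family; equivalently, a section of the pullback of `proj` along `name`. -/
structure FamTm (Γ : C) where
  fam : Fam Γ
  val : Γ ⟶ fam.tot
  w : val ≫ fam.proj = fam.name

/-- Re-indexing of elements. -/
def FamTm.sub {Δ Γ : C} (σ : Δ ⟶ Γ) (a : FamTm Γ) : FamTm Δ where
  fam := a.fam.sub σ
  val := σ ≫ a.val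
  w := (Category.assoc _ _ _).trans (congrArg (fun z => σ ≫ z) a.w)

/-- The morphism underlying an element of `A`. -/
def FamTm.valAs {Γ : C} (a : FamTm Γ) {A : Fam Γ} (h : a.fam = A) : Γ ⟶ A.tot :=
  a.val ≫ eqToHom (congrArg Fam.tot h)

lemma FamTm.valAs_proj {Γ : C} (a : FamTm Γ) {A : Fam Γ} (h : a.fam = A) :
    a.valAs h ≫ A.proj = A.name := by
  subst h; simp [valAs, a.w]

lemma Fam.sub_id {Γ : C} (A : Fam Γ) : A.sub (𝟙 Γ) = A := by
  simp only [Fam.sub, Category.id_comp]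

lemma Fam.sub_comp {Θ Δ Γ : C} (τ : Θ ⟶ Δ) (σ : Δ ⟶ Γ) (A : Fam Γ) :
    A.sub (τ ≫ σ) = (A.sub σ).sub τ := by
  simp only [Fam.sub, Category.assoc]

lemma FamTm.ext_of {Γ : C} {V E : C} {π : E ⟶ V} {n n' : Γ ⟶ V} (hn : n = n') {a a' : Γ ⟶ E}
    (ha : a = a') (w : a ≫ π = n) (w' : a' ≫ π = n') :
    (⟨⟨V, E, π, n⟩, a, w⟩ : FamTm Γ) = ⟨⟨V, E, π, n'⟩, a', w'⟩ := by
  subst hn ha; rfl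

variable [HasPullbacks C]

/-- The comprehension object `Γ.A`. -/
abbrev Fam.cpr {Γ : C} (A : Fam Γ) : C := pullback A.name A.proj

/-- The projection `Γ.A ⟶ Γ`. -/
abbrev Fam.p {Γ : C} (A : Fam Γ) : A.cpr ⟶ Γ := pullback.fst A.name A.proj

/-- The second projection from `Γ.A`, to the total object of the local universe. -/
abbrev Fam.q {Γ : C} (A : Fam Γ) : A.cpr ⟶ A.tot := pullback.snd A.name A.proj

/-- The family `A p` over `Γ.A`. -/
def Fam.wk {Γ : C} (A : Fam Γ) : Fam A.cpr := A.sub A.p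

variable (C) in
/-- The category with families associated to a category with pullbacks and a terminal object. -/
def famCwF [HasTerminal C] : CwF.{v, u, max u v} C where
  emp := ⊤_ C
  empIsTerminal := terminalIsTerminal
  Ty := Fam
  Tm := FamTm
  typ := FamTm.fam
  tySub := Fam.sub
  tmSub := FamTm.sub
  typ_tmSub _ _ := rfl
  tySub_id := Fam.sub_id
  tySub_comp := Fam.sub_comp
  tmSub_id a := FamTm.ext_of (Category.id_comp _) (Category.id_comp _) _ _
  tmSub_comp τ σ a := FamTm.ext_of (Category.assoc _ _ _) (Category.assoc _ _ _) _ _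
  ext A := A.cpr
  p A := A.p
  q A := ⟨A.wk, A.q, pullback.condition.symm⟩
  typ_q _ := rfl
  pair {Δ Γ A} σ a h := pullback.lift σ (a.valAs h) (a.valAs_proj h).symm
  pair_p _ _ _ := pullback.lift_fst _ _ _
  pair_q {Δ Γ A} σ a h := by
    obtain ⟨F, a, ha⟩ := a
    dsimp only at h
    subst h
    refine FamTm.ext_of ?_ ?_ _ _
    · exact (Category.assoc _ _ _).symm.trans
        (congrArg (fun z => z ≫ A.name) (pullback.lift_fst _ _ _))
    · exact (pullback.lift_snd _ _ _).trans (Category.comp_id _)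
  hom_ext {Δ Γ A} f g h h' := by
    refine pullback.hom_ext h ?_
    have := (FamTm.mk.injEq _ _ _ _ _ _).mp h'
    exact eq_of_heq this.2

end Families

/-! ### Ordered commutative ring objects -/

section Ring

variable {C : Type u} [Category.{v} C] [CartesianMonoidalCategory C] [BraidedCategory C]
  [HasFiniteLimits C]

/-- The structure of an ordered commutative ring object on `R`: a commutative ring object with a
subobject `le` of `R ⊗ R` satisfying, in the internal language, the axioms of a total order
compatible with addition and with multiplication of positive elements. Formulas without
disjunction are spelled out at generalized elements; totality says that the join of `le` with its
opposite is the whole of `R ⊗ R`. -/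
class OrderedRingObj (R : C) extends CommRingObj R where
  le : Subobject (R ⊗ R)
  le_refl : ∀ {X : C} (i : X ⟶ R), le.Factors (lift i i)
  le_trans : ∀ {X : C} (i j k : X ⟶ R),
    le.Factors (lift i j) → le.Factors (lift j k) → le.Factors (lift i k)
  le_antisymm : ∀ {X : C} (i j : X ⟶ R), le.Factors (lift i j) → le.Factors (lift j i) → i = j
  le_total : IsLUB {le, (Subobject.pullback (lift (snd R R) (fst R R))).obj le} ⊤
  add_le_add : ∀ {X : C} (i j k : X ⟶ R),
    le.Factors (lift i j) → le.Factors (lift (k + i) (k + j))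
  mul_nonneg : ∀ {X : C} (i j : X ⟶ R),
    le.Factors (lift 0 i) → le.Factors (lift 0 j) → le.Factors (lift 0 (i * j))

variable (R : C) [OrderedRingObj R]

/-- The order relation on generalized elements of `R`. -/
abbrev Le {R : C} [OrderedRingObj R] {X : C} (i j : X ⟶ R) : Prop :=
  (OrderedRingObj.le (R := R)).Factors (lift i j)

lemma Le.comp {R : C} [OrderedRingObj R] {X Y : C} (u : Y ⟶ X) {i j : X ⟶ R} (h : Le i j) :
    Le (u ≫ i) (u ≫ j) := by
  have := Subobject.factors_of_factors_right u h
  rwa [comp_lift] at this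

/-- The positive cone as a subobject of `R`. -/
def cone : Subobject R := (Subobject.pullback (lift 0 (𝟙 R))).obj (OrderedRingObj.le (R := R))

/-- The object `R₊` of positive elements of `R`. -/
def Pos : C := (cone R : C)

/-- The inclusion of `R₊` in `R`. -/
def Pos.incl : Pos R ⟶ R := (cone R).arrow

instance : Mono (Pos.incl R) := inferInstanceAs (Mono (cone R).arrow)

lemma cone_factors_iff {X : C} (i : X ⟶ R) : (cone R).Factors i ↔ Le 0 i := by
  have e : i ≫ lift (0 : R ⟶ R) (𝟙 R) = lift 0 i := by
    rw [comp_lift, Category.comp_id, AddMonObj.comp_zero]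
  rw [cone, Le, ← e]
  exact pullback_factors_iff _ _ _

lemma Pos.incl_nonneg {X : C} (i : X ⟶ Pos R) : Le 0 (i ≫ Pos.incl R) :=
  (cone_factors_iff R _).1 (Subobject.factors_comp_arrow (P := cone R) i)

variable {R}

/-- A positive generalized element of `R` as a generalized element of `R₊`. -/
def Pos.mk {X : C} (i : X ⟶ R) (h : Le 0 i) : X ⟶ Pos R :=
  (cone R).factorThru i ((cone_factors_iff R i).2 h)

@[simp] lemma Pos.mk_incl {X : C} (i : X ⟶ R) (h : Le 0 i) : Pos.mk i h ≫ Pos.incl R = i :=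
  (cone R).factorThru_arrow _ _

variable (R) in
/-- The zero element of `R₊`, at stage `X`. -/
def Pos.zero (X : C) : X ⟶ Pos R := Pos.mk 0 (OrderedRingObj.le_refl 0)

@[simp] lemma Pos.zero_incl (X : C) : Pos.zero R X ≫ Pos.incl R = 0 := Pos.mk_incl _ _

@[simp] lemma Pos.comp_zero {X Y : C} (u : Y ⟶ X) : u ≫ Pos.zero R X = Pos.zero R Y := by
  rw [← cancel_mono (Pos.incl R), Category.assoc, Pos.zero_incl, Pos.zero_incl,
    AddMonObj.comp_zero]

lemma Pos.add_nonneg {X : C} (i j : X ⟶ Pos R) :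
    Le 0 (i ≫ Pos.incl R + j ≫ Pos.incl R) := by
  refine OrderedRingObj.le_trans _ _ _ (Pos.incl_nonneg R i) ?_
  have := OrderedRingObj.add_le_add 0 (j ≫ Pos.incl R) (i ≫ Pos.incl R) (Pos.incl_nonneg R j)
  rwa [add_zero] at this

/-- Addition of generalized elements of `R₊`. -/
def Pos.add {X : C} (i j : X ⟶ Pos R) : X ⟶ Pos R := Pos.mk _ (Pos.add_nonneg i j)

lemma Pos.comp_add {X Y : C} (u : Y ⟶ X) (i j : X ⟶ Pos R) :
    u ≫ Pos.add i j = Pos.add (u ≫ i) (u ≫ j) := by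
  rw [← cancel_mono (Pos.incl R)]
  simp [Pos.add, AddMonObj.comp_add]

lemma Pos.le_add {X : C} (i k : X ⟶ Pos R) :
    Le (i ≫ Pos.incl R) (Pos.add i k ≫ Pos.incl R) := by
  have := OrderedRingObj.add_le_add 0 (k ≫ Pos.incl R) (i ≫ Pos.incl R) (Pos.incl_nonneg R k)
  rw [add_zero] at this
  rw [Pos.add, Pos.mk_incl]
  exact this

lemma Pos.exists_add {X : C} (i j : X ⟶ Pos R)
    (h : Le (i ≫ Pos.incl R) (j ≫ Pos.incl R)) : ∃ k : X ⟶ Pos R, j = Pos.add i k := by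
  have := OrderedRingObj.add_le_add _ _ (-(i ≫ Pos.incl R)) h
  rw [neg_add_cancel] at this
  refine ⟨Pos.mk _ this, ?_⟩
  rw [← cancel_mono (Pos.incl R), Pos.add, Pos.mk_incl, Pos.mk_incl]
  abel

end Ring

/-! ### Moore paths -/

section Paths

variable {C : Type u} [Category.{v} C] [CartesianMonoidalCategory C] [BraidedCategory C]
  [HasFiniteLimits C] (R : C) [OrderedRingObj R]

/-- A Moore path in `Γ` at stage `X`, that is, in the context `X` of the internal language:
a pair `(f, i)` of a function `f : R₊ → Γ` and an element `i : R₊` (the shape), such that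
`f 0 = src` and `f j = tgt` for all `j ≥ i`. -/
@[ext] structure MPath (X Γ : C) where
  src : X ⟶ Γ
  tgt : X ⟶ Γ
  fn : Pos R ⊗ X ⟶ Γ
  shape : X ⟶ Pos R
  at_zero : lift (Pos.zero R X) (𝟙 X) ≫ fn = src
  at_ge : ∀ {Y : C} (t : Y ⟶ X) (j : Y ⟶ Pos R),
    Le (t ≫ shape ≫ Pos.incl R) (j ≫ Pos.incl R) → lift j t ≫ fn = t ≫ tgt

variable {R}

namespace MPath

/-- Restriction of a path along a change of stage. -/
@[simps] def restrict {X Y Γ : C} (t : Y ⟶ X) (p : MPath R X Γ) : MPath R Y Γ where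
  src := t ≫ p.src
  tgt := t ≫ p.tgt
  fn := (Pos R ◁ t) ≫ p.fn
  shape := t ≫ p.shape
  at_zero := by
    rw [← p.at_zero, lift_whiskerLeft_assoc, comp_lift_assoc, Pos.comp_zero]; simp
  at_ge s j h := by
    rw [lift_whiskerLeft_assoc, p.at_ge (s ≫ t) j (by simpa using h), Category.assoc]

/-- The congruence operation: the image of a path under a morphism. -/
@[simps] def map {X Γ Δ : C} (γ : Γ ⟶ Δ) (p : MPath R X Γ) : MPath R X Δ where
  src := p.src ≫ γ
  tgt := p.tgt ≫ γ
  fn := p.fn ≫ γ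
  shape := p.shape
  at_zero := by rw [← p.at_zero, Category.assoc]
  at_ge s j h := by rw [← Category.assoc, p.at_ge s j h, Category.assoc]

variable (R) in
/-- The degenerate path at `x`, of shape zero. -/
@[simps] def idp {X Γ : C} (x : X ⟶ Γ) : MPath R X Γ where
  src := x
  tgt := x
  fn := snd _ _ ≫ x
  shape := Pos.zero R X
  at_zero := by simp
  at_ge s j _ := by simp

lemma map_id {X Γ : C} (p : MPath R X Γ) : p.map (𝟙 Γ) = p := by
  ext <;> simp

lemma map_comp {X Γ Δ Θ : C} (p : MPath R X Γ) (γ : Γ ⟶ Δ) (δ : Δ ⟶ Θ) :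
    p.map (γ ≫ δ) = (p.map γ).map δ := by
  ext <;> simp

lemma map_restrict {X Y Γ Δ : C} (t : Y ⟶ X) (p : MPath R X Γ) (γ : Γ ⟶ Δ) :
    (p.restrict t).map γ = (p.map γ).restrict t := by
  ext <;> simp

lemma map_idp {X Γ Δ : C} (x : X ⟶ Γ) (γ : Γ ⟶ Δ) : (idp R x).map γ = idp R (x ≫ γ) := by
  ext <;> simp

end MPath

/-! ### Objects of Moore paths in the fibres of a morphism -/

section PathObject

variable [MonoidalClosed C]

variable (R) in
/-- The object of pairs `(f, i)` with `f : R₊ → E` and `i : R₊`. -/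
abbrev PrePath (E : C) : C := (ihom (Pos R)).obj E ⊗ Pos R

/-- `f k` for the generic pair `(f, i)`, at a stage carrying `k : R₊` and `(f, i)`. -/
def PrePath.app {E X : C} (k : X ⟶ Pos R) (m : X ⟶ PrePath R E) : X ⟶ E :=
  lift k (m ≫ fst _ _) ≫ (ihom.ev (Pos R)).app E

lemma PrePath.comp_app {E X Y : C} (t : Y ⟶ X) (k : X ⟶ Pos R) (m : X ⟶ PrePath R E) :
    t ≫ PrePath.app k m = PrePath.app (t ≫ k) (t ≫ m) := by
  simp [PrePath.app, comp_lift_assoc]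

variable (R) in
/-- The object of Moore paths in the fibres of `π`: the object of those `(f, i)` such that,
for all `k : R₊`, `f (i + k) = f i` and `π (f k) = π (f 0)`. Its generalized elements are
identified in `existsUnique_pathObj`. -/
def pathObj {E V : C} (π : E ⟶ V) : C :=
  equalizer
    (lift
      (MonoidalClosed.curry
        (PrePath.app (Pos.add (snd (Pos R) (PrePath R E) ≫ snd _ _) (fst _ _)) (snd _ _)))
      (MonoidalClosed.curry
        (PrePath.app (fst (Pos R) (PrePath R E)) (snd _ _) ≫ π)))
    (lift
      (MonoidalClosed.curry
        (PrePath.app (snd (Pos R) (PrePath R E) ≫ snd _ _) (snd _ _)))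
      (MonoidalClosed.curry
        (PrePath.app (Pos.zero R (Pos R ⊗ PrePath R E)) (snd _ _) ≫ π)))

variable (R) in
/-- The inclusion of the object of Moore paths in the object of pairs `(f, i)`. -/
def pathIncl {E V : C} (π : E ⟶ V) : pathObj R π ⟶ PrePath R E := equalizer.ι _ _

instance {E V : C} (π : E ⟶ V) : Mono (pathIncl R π) :=
  inferInstanceAs (Mono (equalizer.ι _ _))

/-- The condition for a generalized element of the object of pairs to be a Moore path in a fibre
of `π`. -/
lemma pathObj_cond_iff {E V X : C} (π : E ⟶ V) (m : X ⟶ PrePath R E) :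
    (∃ n : X ⟶ pathObj R π, n ≫ pathIncl R π = m) ↔
      ∀ {Y : C} (t : Y ⟶ X) (k : Y ⟶ Pos R),
        PrePath.app (Pos.add (t ≫ m ≫ snd _ _) k) (t ≫ m) =
            PrePath.app (t ≫ m ≫ snd _ _) (t ≫ m) ∧
          PrePath.app k (t ≫ m) ≫ π = PrePath.app (Pos.zero R Y) (t ≫ m) ≫ π := by
  have key : ∀ {Z : C} (a b : Pos R ⊗ PrePath R E ⟶ Z),
      m ≫ MonoidalClosed.curry a = m ≫ MonoidalClosed.curry b ↔
        ∀ {Y : C} (t : Y ⟶ X) (k : Y ⟶ Pos R), lift k (t ≫ m) ≫ a = lift k (t ≫ m) ≫ b := by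
    intro Z a b
    rw [← MonoidalClosed.curry_natural_left, ← MonoidalClosed.curry_natural_left,
      (MonoidalClosed.curry_injective).eq_iff]
    constructor
    · intro h Y t k
      have := congrArg (fun z => lift k t ≫ z) h
      simpa [lift_whiskerLeft_assoc] using this
    · intro h
      have := h (snd (Pos R) X) (fst (Pos R) X)
      have e : lift (fst (Pos R) X) (snd (Pos R) X ≫ m) = Pos R ◁ m := by
        ext <;> simp
      rwa [e] at this
  have e₁ : (∃ n : X ⟶ pathObj R π, n ≫ pathIncl R π = m) ↔
      m ≫ lift
        (MonoidalClosed.curry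
          (PrePath.app (Pos.add (snd (Pos R) (PrePath R E) ≫ snd _ _) (fst _ _)) (snd _ _)))
        (MonoidalClosed.curry
          (PrePath.app (fst (Pos R) (PrePath R E)) (snd _ _) ≫ π)) =
      m ≫ lift
        (MonoidalClosed.curry
          (PrePath.app (snd (Pos R) (PrePath R E) ≫ snd _ _) (snd _ _)))
        (MonoidalClosed.curry
          (PrePath.app (Pos.zero R (Pos R ⊗ PrePath R E)) (snd _ _) ≫ π)) := by
    constructor
    · rintro ⟨n, rfl⟩
      rw [Category.assoc, Category.assoc]
      exact congrArg (fun z => n ≫ z) (equalizer.condition _ _)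
    · intro h
      exact ⟨equalizer.lift m h, equalizer.lift_ι m h⟩
  rw [e₁, comp_lift, comp_lift]
  have e₂ : ∀ {Z₁ Z₂ : C} (a b : X ⟶ Z₁) (c d : X ⟶ Z₂),
      lift a c = lift b d ↔ a = b ∧ c = d := by
    intro Z₁ Z₂ a b c d
    constructor
    · intro h
      exact ⟨by simpa using congrArg (fun z => z ≫ fst _ _) h,
        by simpa using congrArg (fun z => z ≫ snd _ _) h⟩
    · rintro ⟨rfl, rfl⟩; rfl
  rw [e₂, key, key]
  simp only [← Category.assoc, PrePath.comp_app, Pos.comp_add, Pos.comp_zero, lift_fst, lift_snd]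
  exact ⟨fun h _ t k => ⟨h.1 t k, h.2 t k⟩, fun h => ⟨fun t k => (h t k).1, fun t k => (h t k).2⟩⟩

variable (R) in
/-- The generic Moore path in a fibre of `π`. -/
def genPath {E V : C} (π : E ⟶ V) : MPath R (pathObj R π) E where
  src := PrePath.app (Pos.zero R _) (pathIncl R π)
  tgt := PrePath.app (pathIncl R π ≫ snd _ _) (pathIncl R π)
  fn := PrePath.app (fst _ _) (snd _ _ ≫ pathIncl R π)
  shape := pathIncl R π ≫ snd _ _
  at_zero := by rw [PrePath.comp_app]; simp
  at_ge t j h := by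
    rw [Category.assoc] at h
    obtain ⟨k, rfl⟩ := Pos.exists_add (t ≫ pathIncl R π ≫ snd _ _) j (by simpa using h)
    have := ((pathObj_cond_iff π (pathIncl R π)).1 ⟨𝟙 _, Category.id_comp _⟩ t k).1
    rw [PrePath.comp_app, PrePath.comp_app, lift_fst, lift_snd_assoc]
    exact this

/-- The Moore path in a fibre of `π` corresponding to a generalized element of the object of such
paths. -/
def toPath {E V X : C} {π : E ⟶ V} (m : X ⟶ pathObj R π) : MPath R X E := (genPath R π).restrict m

lemma toPath_fiber {E V X : C} {π : E ⟶ V} (m : X ⟶ pathObj R π) :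
    (toPath m).fn ≫ π = snd _ _ ≫ (toPath m).src ≫ π := by
  have := ((pathObj_cond_iff π (m ≫ pathIncl R π)).1 ⟨m, rfl⟩ (snd (Pos R) X) (fst (Pos R) X)).2
  have e₁ : (toPath m).fn =
      PrePath.app (fst (Pos R) X) (snd (Pos R) X ≫ m ≫ pathIncl R π) := by
    simp [toPath, genPath, PrePath.comp_app]
  have e₂ : snd (Pos R) X ≫ (toPath m).src =
      PrePath.app (Pos.zero R _) (snd (Pos R) X ≫ m ≫ pathIncl R π) := by
    simp [toPath, genPath, PrePath.comp_app]
  rw [← Category.assoc (snd _ _), e₂, e₁]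
  exact this

lemma toPath_src_proj {E V X : C} {π : E ⟶ V} (m : X ⟶ pathObj R π) :
    (toPath m).src ≫ π = (toPath m).tgt ≫ π := by
  have h := congrArg (fun z => lift (toPath m).shape (𝟙 X) ≫ z) (toPath_fiber m)
  have h' := (toPath m).at_ge (𝟙 X) (toPath m).shape
    (by rw [Category.id_comp]; exact OrderedRingObj.le_refl _)
  simp only [lift_snd_assoc, Category.id_comp] at h h'
  rw [← h, ← h', Category.assoc]

/-- The object `pathObj R π` classifies Moore paths lying in a fibre of `π`. -/
lemma existsUnique_pathObj {E V X : C} (π : E ⟶ V) (p : MPath R X E)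
    (hp : p.fn ≫ π = snd _ _ ≫ p.src ≫ π) : ∃! m : X ⟶ pathObj R π, toPath m = p := by
  have happ : ∀ {Y : C} (t : Y ⟶ X) (k : Y ⟶ Pos R),
      PrePath.app k (t ≫ lift (MonoidalClosed.curry p.fn) p.shape) = lift k t ≫ p.fn := by
    intro Y t k
    have e : lift k (t ≫ MonoidalClosed.curry p.fn) =
        lift k t ≫ Pos R ◁ MonoidalClosed.curry p.fn := by simp
    rw [PrePath.app, Category.assoc, lift_fst, e, Category.assoc, ← MonoidalClosed.uncurry_eq,
      MonoidalClosed.uncurry_curry]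
  obtain ⟨m, hm⟩ := (pathObj_cond_iff π (lift (MonoidalClosed.curry p.fn) p.shape)).2 (by
    intro Y t k
    rw [happ, happ, happ, happ, lift_snd]
    refine ⟨?_, ?_⟩
    · rw [p.at_ge t (t ≫ p.shape) (by rw [Category.assoc]; exact OrderedRingObj.le_refl _)]
      exact p.at_ge t _ (by simpa using Pos.le_add (t ≫ p.shape) k)
    · rw [Category.assoc, Category.assoc, hp, lift_snd_assoc, lift_snd_assoc])
  have hfn : ∀ n : X ⟶ pathObj R π, (toPath n).fn = PrePath.app (fst _ _)
      (snd _ _ ≫ n ≫ pathIncl R π) := by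
    intro n; simp [toPath, genPath, PrePath.comp_app]
  have hsh : ∀ n : X ⟶ pathObj R π, (toPath n).shape = n ≫ pathIncl R π ≫ snd _ _ := by
    intro n; simp [toPath, genPath]
  have h1 : (toPath m).fn = p.fn := by rw [hfn, hm, happ]; simp
  have h2 : (toPath m).shape = p.shape := by rw [hsh, ← Category.assoc, hm, lift_snd]
  refine ⟨m, ?_, ?_⟩
  · ext1
    · rw [← (toPath m).at_zero, ← p.at_zero, h1]
    · have a := (toPath m).at_ge (𝟙 X) (toPath m).shape
        (by rw [Category.id_comp]; exact OrderedRingObj.le_refl _)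
      have b := p.at_ge (𝟙 X) p.shape
        (by rw [Category.id_comp]; exact OrderedRingObj.le_refl _)
      rw [Category.id_comp] at a b
      rw [← a, ← b, h1, h2]
    · exact h1
    · exact h2
  · intro n hn
    rw [← cancel_mono (pathIncl R π), hm]
    ext
    · rw [lift_fst, ← MonoidalClosed.uncurry_injective.eq_iff, MonoidalClosed.uncurry_curry, ← hn,
        hfn, MonoidalClosed.uncurry_eq, PrePath.app]
      congr 1
      ext <;> simp
    · rw [lift_snd, ← hn, hsh, Category.assoc]

variable (R) in
/-- The family `(a₁ ∼ a₂ | ((x, a₁), a₂) : Γ.A.A p)` of objects of Moore paths in the fibres of the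
family `A`: its local universe is the family of all path objects of fibres of `A.proj`, indexed by
pairs of points in the same fibre. -/
def mooreId {Γ : C} (A : Fam Γ) : Fam A.wk.cpr where
  base := pullback A.proj A.proj
  tot := pathObj R A.proj
  proj := pullback.lift (genPath R A.proj).src (genPath R A.proj).tgt (by
    simpa [toPath] using toPath_src_proj (𝟙 (pathObj R A.proj)))
  name := pullback.lift (A.wk.p ≫ A.q) A.wk.q (by
    rw [Category.assoc, ← pullback.condition (f := A.name) (g := A.proj)]
    exact pullback.condition (f := A.wk.name) (g := A.wk.proj))

end PathObject

/-! ### Transport along paths -/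

variable (R) in
/-- A transport-along-paths structure on the family `A` over `Γ`: functions
`x ∼ y → (A x → A y)` for `x, y : Γ`, in the internal language, that is, functions at every stage
`X` which are natural in `X`; transport along degenerate paths is the identity. -/
structure Tap {Γ : C} (A : Fam Γ) where
  tr : ∀ {X : C} (p : MPath R X Γ) (a : X ⟶ A.tot), a ≫ A.proj = p.src ≫ A.name → (X ⟶ A.tot)
  tr_proj : ∀ {X : C} (p : MPath R X Γ) (a : X ⟶ A.tot) (h : a ≫ A.proj = p.src ≫ A.name),
    tr p a h ≫ A.proj = p.tgt ≫ A.name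
  tr_restrict : ∀ {X Y : C} (t : Y ⟶ X) (p : MPath R X Γ) (a : X ⟶ A.tot)
    (h : a ≫ A.proj = p.src ≫ A.name),
    tr (p.restrict t) (t ≫ a) (by simp [h]) = t ≫ tr p a h
  tr_idp : ∀ {X : C} (x : X ⟶ Γ) (a : X ⟶ A.tot) (h : a ≫ A.proj = x ≫ A.name),
    tr (MPath.idp R x) a h = a

/-- Re-indexing of transport-along-paths structures, via the congruence operation. -/
def Tap.sub {Δ Γ : C} (σ : Δ ⟶ Γ) {A : Fam Γ} (s : Tap R A) : Tap R (A.sub σ) where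
  tr p a h := s.tr (p.map σ) a (h.trans (Category.assoc _ _ _).symm)
  tr_proj p a h := (s.tr_proj (p.map σ) a _).trans (Category.assoc _ _ _)
  tr_restrict t p a h := by
    simp only [MPath.map_restrict]
    exact s.tr_restrict t (p.map σ) a (h.trans (Category.assoc _ _ _).symm)
  tr_idp x a h := by
    simp only [MPath.map_idp]
    exact s.tr_idp (x ≫ σ) a (h.trans (Category.assoc _ _ _).symm)

variable (R) in
/-- A fibration over `Γ`: a family with a transport-along-paths structure. -/
structure FibTy (Γ : C) where
  fam : Fam Γ
  tap : Tap R fam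

/-- Re-indexing of fibrations. -/
def FibTy.sub {Δ Γ : C} (σ : Δ ⟶ Γ) (A : FibTy R Γ) : FibTy R Δ where
  fam := A.fam.sub σ
  tap := A.tap.sub σ

lemma FibTy.ext_of {Γ : C} {V E : C} {π : E ⟶ V} {n n' : Γ ⟶ V} (hn : n = n')
    (s : Tap R (⟨V, E, π, n⟩ : Fam Γ)) (s' : Tap R (⟨V, E, π, n'⟩ : Fam Γ))
    (h : ∀ {X : C} (p : MPath R X Γ) (a : X ⟶ E) (h₁ : a ≫ π = p.src ≫ n)
      (h₂ : a ≫ π = p.src ≫ n'), s.tr p a h₁ = s'.tr p a h₂) :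
    (⟨⟨V, E, π, n⟩, s⟩ : FibTy R Γ) = ⟨⟨V, E, π, n'⟩, s'⟩ := by
  subst hn
  congr 1
  obtain ⟨tr, _, _, _⟩ := s
  obtain ⟨tr', _, _, _⟩ := s'
  congr 1
  funext X p a h₁
  exact h p a h₁ h₁

lemma FibTy.sub_id {Γ : C} (A : FibTy R Γ) : A.sub (𝟙 Γ) = A := by
  refine FibTy.ext_of (Category.id_comp _) _ _ ?_
  intro X p a h₁ h₂
  simp only [Tap.sub, MPath.map_id]

lemma FibTy.sub_comp {Θ Δ Γ : C} (τ : Θ ⟶ Δ) (σ : Δ ⟶ Γ) (A : FibTy R Γ) :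
    A.sub (τ ≫ σ) = (A.sub σ).sub τ := by
  refine FibTy.ext_of (Category.assoc _ _ _) _ _ ?_
  intro X p a h₁ h₂
  simp only [Tap.sub, MPath.map_comp]
  rfl

variable (R) in
/-- An element of a fibration: an element of the underlying family. -/
@[ext] structure FibTm (Γ : C) where
  ty : FibTy R Γ
  elt : FamTm Γ
  fam_elt : elt.fam = ty.fam

variable (R) in
/-- The category with families `Fib`, whose families are the fibrations and whose elements are the
elements of the underlying families. -/
def Fib : CwF.{v, u, max u v} C where
  emp := (famCwF C).emp
  empIsTerminal := (famCwF C).empIsTerminal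
  Ty := FibTy R
  Tm := FibTm R
  typ := FibTm.ty
  tySub := FibTy.sub
  tmSub σ a := ⟨a.ty.sub σ, a.elt.sub σ, congrArg (Fam.sub σ) a.fam_elt⟩
  typ_tmSub _ _ := rfl
  tySub_id := FibTy.sub_id
  tySub_comp := FibTy.sub_comp
  tmSub_id a := FibTm.ext (FibTy.sub_id _) ((famCwF C).tmSub_id a.elt)
  tmSub_comp τ σ a := FibTm.ext (FibTy.sub_comp _ _ _) ((famCwF C).tmSub_comp τ σ a.elt)
  ext A := A.fam.cpr
  p A := A.fam.p
  q A := ⟨A.sub A.fam.p, (famCwF C).q A.fam, rfl⟩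
  typ_q _ := rfl
  pair {Δ Γ A} σ a h :=
    (famCwF C).pair (A := A.fam) σ a.elt (a.fam_elt.trans (congrArg FibTy.fam h))
  pair_p {Δ Γ A} σ a h := (famCwF C).pair_p (A := A.fam) σ a.elt _
  pair_q {Δ Γ A} σ a h := by
    refine FibTm.ext ?_ ((famCwF C).pair_q (A := A.fam) σ a.elt _)
    refine Eq.trans ?_ h.symm
    refine Eq.trans (FibTy.sub_comp _ _ _).symm ?_
    exact congrArg (fun z => A.sub z) ((famCwF C).pair_p (A := A.fam) σ a.elt _)
  hom_ext {Δ Γ A} f g h h' := (famCwF C).hom_ext (A := A.fam) f g h (congrArg FibTm.elt h')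

/-- The morphism underlying an element of a fibration `A`. -/
def FibTy.elVal {Γ : C} {A : FibTy R Γ} (a : (Fib R).El A) : Γ ⟶ A.fam.tot :=
  a.1.elt.valAs (a.1.fam_elt.trans (congrArg FibTy.fam a.2))

/-! ### Identity types -/

section Id

variable [MonoidalClosed C]

/-- The fibration given by the Moore path family of a fibration `A`, for a given choice of
transport-along-paths structures on all such families. -/
def mooreIdFib (t : ∀ (Γ : C) (A : FibTy R Γ), Tap R (mooreId R A.fam)) (Γ : C) (A : FibTy R Γ) :
    (Fib R).Ty ((Fib R).ext ((Fib R).wk A)) :=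
  ⟨mooreId R A.fam, t Γ A⟩

variable {Γ : C} {A : Fam Γ} {X : C}

/-- The component `(x, a₁)` of a generalized element `(((x, a₁), a₂), p)` of `Γ.A.A p.Id_A`. -/
def idLeft (e : X ⟶ (mooreId R A).cpr) : X ⟶ A.cpr :=
  (e ≫ (mooreId R A).p) ≫ A.wk.p

/-- The component `a₂` of a generalized element `(((x, a₁), a₂), p)` of `Γ.A.A p.Id_A`. -/
def idRight (e : X ⟶ (mooreId R A).cpr) : X ⟶ A.tot :=
  (e ≫ (mooreId R A).p) ≫ A.wk.q

/-- The component `p : a₁ ∼ a₂` of a generalized element `(((x, a₁), a₂), p)` of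
`Γ.A.A p.Id_A`. -/
def idPath (e : X ⟶ (mooreId R A).cpr) : MPath R X A.tot :=
  toPath (e ≫ (mooreId R A).q)

/-- `c` is the contraction path of `e = (((x, a₁), a₂), p)`: it has the shape of `p`, and its value
at `i ≤ |p|` is `(((x, a₁), p i), q)`, where `q` has shape `i` and agrees with `p` up to `i`. -/
structure IsContraction (e : X ⟶ (mooreId R A).cpr) (c : MPath R X (mooreId R A).cpr) :
    Prop where
  shape_eq : c.shape = (idPath e).shape
  left : ∀ {Y : C} (s : Y ⟶ X) (i : Y ⟶ Pos R),
    Le (i ≫ Pos.incl R) (s ≫ c.shape ≫ Pos.incl R) → idLeft (lift i s ≫ c.fn) = s ≫ idLeft e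
  right : ∀ {Y : C} (s : Y ⟶ X) (i : Y ⟶ Pos R),
    Le (i ≫ Pos.incl R) (s ≫ c.shape ≫ Pos.incl R) →
      idRight (lift i s ≫ c.fn) = lift i s ≫ (idPath e).fn
  path_shape : ∀ {Y : C} (s : Y ⟶ X) (i : Y ⟶ Pos R),
    Le (i ≫ Pos.incl R) (s ≫ c.shape ≫ Pos.incl R) → (idPath (lift i s ≫ c.fn)).shape = i
  path_fn : ∀ {Y : C} (s : Y ⟶ X) (i : Y ⟶ Pos R),
    Le (i ≫ Pos.incl R) (s ≫ c.shape ≫ Pos.incl R) →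
      ∀ {Z : C} (r : Z ⟶ Y) (j : Z ⟶ Pos R), Le (j ≫ Pos.incl R) (r ≫ i ≫ Pos.incl R) →
        lift j r ≫ (idPath (lift i s ≫ c.fn)).fn = lift j (r ≫ s) ≫ (idPath e).fn

end Id

end Paths

end

end MooreTT

open MooreTT

/-!
The interpretation works because every construction on Moore paths can be carried out on
generalized elements: a path at stage `X` is determined by its shape and its values `p.ev t j`, and
naturality in the stage is checked on those values.

The only case distinction needed is `i ≤ j ∨ j ≤ i` on `R₊`. In a topos two morphisms that agree on
the overlap of a cover by two subobjects can be glued: the predicate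
`(x ∈ U → z = f x) ∧ (x ∈ V → z = g x)` on `z` is a morphism into `Ω ^ Z` which lies in the image of
the singleton map over both `U` and `V`, hence everywhere (`exists_glue`). Such covers are stable
under pullback because universal quantification along a morphism exists
(`subobject_eq_top_of_cover`). Gluing supplies minima and truncated subtraction on `R₊`, and so the
initial part `trunc`, the final part `drop`, the reverse `rev` and the concatenation `concat` of
paths. Concatenation with a path of shape `0` is strictly the identity.

A path in `Γ.A` from `(x, a)` to `(y, b)` over `γ : x ∼ y` yields a path `γ_* a ∼ b` in `A y`, which
at `j` is the transport of the value at `j` along the part of `γ` from `j` on (`Tap.drag`). A path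
`q : a₁ ∼ a₂` in `A x` is transported along a path in `Γ.A.A p` by applying `γ_*` pointwise and
composing with these connecting paths at both ends (`Tap.conj`). Along a degenerate path the ends
have shape `0` and `γ_*` is the identity, so the result is `q` itself: this is the transport
structure `mooreTap` on the identity types.

The contraction path of `(((x, a₁), a₂), p)` takes at `i` the value given by the initial part of `p`
up to `i` (`contr`); it is degenerate at reflexivity, so that transport along it, the eliminator
`elim`, satisfies the computation rule strictly. Stability under re-indexing holds because a
generalized element of `Γ.A.A p.Id_A` is determined by its components in `Γ` and in the object of
paths (`id_hom_ext`), and all constructions are natural in these.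
-/

namespace MooreTT

noncomputable section

/-! ### Covers and gluing in a topos -/

section Topos

variable {C : Type u} [Category.{v} C]

lemma subobject_le_of_factors {X : C} {U V : Subobject X}
    (h : ∀ {Y : C} (t : Y ⟶ X), U.Factors t → V.Factors t) : U ≤ V :=
  Subobject.le_of_comm (V.factorThru U.arrow (h _ U.factors_self)) (by simp)

variable [HasSubobjectClassifier C]

variable (C) in
/-- The object of truth values. -/
abbrev Truth : C := HasSubobjectClassifier.Ω C

/-- A truth value at stage `X` holds when it factors through `truth`. -/
def Holds {X : C} (φ : X ⟶ Truth C) : Prop :=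
  (Subobject.mk (HasSubobjectClassifier.truth C)).Factors φ

/-- The characteristic morphism of a subobject. -/
def char {X : C} (U : Subobject X) : X ⟶ Truth C := HasSubobjectClassifier.χ U.arrow

lemma holds_comp_char {X Y : C} (U : Subobject X) (t : Y ⟶ X) :
    Holds (t ≫ char U) ↔ U.Factors t := by
  have sq := HasSubobjectClassifier.isPullback_χ U.arrow
  rw [Holds, Subobject.mk_factors_iff]
  constructor
  · rintro ⟨k, hk⟩
    rw [← Subobject.mk_arrow U, Subobject.mk_factors_iff]
    exact ⟨sq.lift t k hk.symm, sq.lift_fst _ _ _⟩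
  · intro h
    refine ⟨U.factorThru t h ≫ Subobject.Classifier.χ₀ _ _, ?_⟩
    change (_ ≫ _) ≫ HasSubobjectClassifier.truth C = _
    rw [Category.assoc, ← sq.w, Subobject.factorThru_arrow_assoc]; rfl

variable [HasFiniteLimits C]

/-- Truth values are equal when they hold at the same later stages. -/
lemma truth_ext {X : C} {φ ψ : X ⟶ Truth C}
    (h : ∀ {Y : C} (t : Y ⟶ X), Holds (t ≫ φ) ↔ Holds (t ≫ ψ)) : φ = ψ := by
  let c : Subobject.Classifier C := HasSubobjectClassifier.exists_classifier.some
  apply (c.representableBy.homEquiv (X := X)).injective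
  have key : ∀ φ : X ⟶ Truth C, c.representableBy.homEquiv φ =
      (Subobject.pullback φ).obj (Subobject.mk (HasSubobjectClassifier.truth C)) :=
    fun φ => rfl
  rw [key, key]
  refine le_antisymm (α := Subobject X) ?_ ?_ <;> apply subobject_le_of_factors <;> intro Y t
  · rw [pullback_factors_iff, pullback_factors_iff]; exact (h t).1
  · rw [pullback_factors_iff, pullback_factors_iff]; exact (h t).2

variable [CartesianMonoidalCategory C] [MonoidalClosed C]

/-- Generalized elements of the object of predicates on `Z`, given by currying, are equal when the
predicates hold for the same generalized elements of `Z`. -/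
lemma comp_curry_eq_iff {X Y Z V : C} (t : Y ⟶ X) (s : Y ⟶ V) (a : Z ⊗ X ⟶ Truth C)
    (b : Z ⊗ V ⟶ Truth C) :
    t ≫ MonoidalClosed.curry a = s ≫ MonoidalClosed.curry b ↔
      ∀ {T : C} (z : T ⟶ Z) (y : T ⟶ Y),
        Holds (lift z (y ≫ t) ≫ a) ↔ Holds (lift z (y ≫ s) ≫ b) := by
  rw [← MonoidalClosed.curry_natural_left, ← MonoidalClosed.curry_natural_left,
    MonoidalClosed.curry_injective.eq_iff]
  constructor
  · intro h T z y
    have := congrArg (fun k => lift z y ≫ k) h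
    simp only [lift_whiskerLeft_assoc] at this
    rw [this]
  · intro h
    refine truth_ext fun {T} k => ?_
    have e : k = lift (k ≫ fst _ _) (k ≫ snd _ _) := by ext <;> simp
    rw [e, lift_whiskerLeft_assoc, lift_whiskerLeft_assoc]
    exact h _ _

/-- Covers by two subobjects are stable under pullback: if `U` and `V` cover `B`, a subobject of `X`
containing their inverse images under `h` is everything. -/
lemma subobject_eq_top_of_cover {B X : C} {U V : Subobject B} (hUV : IsLUB {U, V} ⊤) (h : X ⟶ B)
    (W : Subobject X)
    (hU : ∀ {Y : C} (t : Y ⟶ X), U.Factors (t ≫ h) → W.Factors t)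
    (hV : ∀ {Y : C} (t : Y ⟶ X), V.Factors (t ≫ h) → W.Factors t) : W = ⊤ := by
  -- `D` is the subobject `∀ x, h x = b → x ∈ W` of `B`, obtained by comparing the predicates
  -- `h x = b` and `h x = b ∧ x ∈ W` on `X`; it contains `U` and `V`
  let a : Subobject (X ⊗ B) := equalizerSubobject (fst X B ≫ h) (snd X B)
  let b : Subobject (X ⊗ B) := a ⊓ (Subobject.pullback (fst X B)).obj W
  have ha : ∀ {T : C} (x : T ⟶ X) (z : T ⟶ B), Holds (lift x z ≫ char a) ↔ x ≫ h = z := by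
    intro T x z
    rw [holds_comp_char, equalizerSubobject_factors_iff]; simp
  have hb : ∀ {T : C} (x : T ⟶ X) (z : T ⟶ B),
      Holds (lift x z ≫ char b) ↔ x ≫ h = z ∧ W.Factors x := by
    intro T x z
    rw [holds_comp_char, Subobject.inf_factors, ← holds_comp_char, ha, pullback_factors_iff,
      lift_fst]
  let D : Subobject B :=
    equalizerSubobject (MonoidalClosed.curry (char a)) (MonoidalClosed.curry (char b))
  have hD : ∀ {Y : C} (t : Y ⟶ B), D.Factors t ↔
      ∀ {T : C} (x : T ⟶ X) (y : T ⟶ Y), x ≫ h = y ≫ t → W.Factors x := by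
    intro Y t
    rw [equalizerSubobject_factors_iff, comp_curry_eq_iff]
    simp only [ha, hb]
    exact ⟨fun H T x y e => ((H x y).1 e).2, fun H T x y => ⟨fun e => ⟨e, H x y e⟩, And.left⟩⟩
  have hDtop : ⊤ ≤ D := by
    refine hUV.2 ?_
    rintro P (rfl | rfl)
    · refine subobject_le_of_factors fun t ht => (hD t).2 fun x y e => hU x ?_
      rw [e]; exact Subobject.factors_of_factors_right _ ht
    · refine subobject_le_of_factors fun t ht => (hD t).2 fun x y e => hV x ?_
      rw [e]; exact Subobject.factors_of_factors_right _ ht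
  have h1 : D.Factors h := by
    rw [top_le_iff.1 hDtop]; exact Subobject.top_factors _
  have h2 := (hD h).1 h1 (𝟙 X) (𝟙 X) rfl
  rw [← top_le_iff]
  exact subobject_le_of_factors fun t _ => by
    simpa using Subobject.factors_of_factors_right t h2

/-- Gluing of two morphisms along a cover by two subobjects on whose intersection they agree. -/
lemma exists_glue {X Z : C} (U V : Subobject X)
    (hUV : ∀ W : Subobject X, U ≤ W → V ≤ W → W = ⊤) (f g : X ⟶ Z)
    (hfg : ∀ {Y : C} (t : Y ⟶ X), U.Factors t → V.Factors t → t ≫ f = t ≫ g) :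
    ∃ k : X ⟶ Z, (∀ {Y : C} (t : Y ⟶ X), U.Factors t → t ≫ k = t ≫ f) ∧
      ∀ {Y : C} (t : Y ⟶ X), V.Factors t → t ≫ k = t ≫ g := by
  -- the implications `x ∈ U → z = f x`, as an equality of the truth values `x ∈ U` and
  -- `x ∈ U ∧ z = f x`
  let imp (P : Subobject X) (r : X ⟶ Z) : Subobject (Z ⊗ X) :=
    equalizerSubobject (snd Z X ≫ char P)
      (char ((Subobject.pullback (snd Z X)).obj P ⊓
        equalizerSubobject (fst Z X) (snd Z X ≫ r)))
  have himp : ∀ (P : Subobject X) (r : X ⟶ Z) {Y : C} (z : Y ⟶ Z) (x : Y ⟶ X),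
      (imp P r).Factors (lift z x) ↔
        ∀ {T : C} (t : T ⟶ Y), P.Factors (t ≫ x) → t ≫ z = t ≫ x ≫ r := by
    intro P r Y z x
    have e : ∀ {T : C} (t : T ⟶ Y),
        (Holds (t ≫ lift z x ≫ snd Z X ≫ char P) ↔ P.Factors (t ≫ x)) ∧
        (Holds (t ≫ lift z x ≫ char ((Subobject.pullback (snd Z X)).obj P ⊓
          equalizerSubobject (fst Z X) (snd Z X ≫ r))) ↔
            P.Factors (t ≫ x) ∧ t ≫ z = t ≫ x ≫ r) := by
      intro T t
      constructor
      · rw [lift_snd_assoc, ← Category.assoc, holds_comp_char]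
      · rw [← Category.assoc, holds_comp_char, Subobject.inf_factors, pullback_factors_iff,
          equalizerSubobject_factors_iff]
        simp
    rw [equalizerSubobject_factors_iff]
    constructor
    · intro H T t ht
      have := congrArg (fun k => Holds (t ≫ k)) H
      rw [(e t).1, (e t).2] at this
      exact (this ▸ ht).2
    · intro H
      refine truth_ext fun t => ?_
      rw [(e t).1, (e t).2]
      exact ⟨fun ht => ⟨ht, H t ht⟩, And.left⟩
  let S : Subobject (Z ⊗ X) := imp U f ⊓ imp V g
  let δ : Subobject (Z ⊗ Z) := equalizerSubobject (fst Z Z) (snd Z Z)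
  have hδ : ∀ {T : C} (a b : T ⟶ Z), Holds (lift a b ≫ char δ) ↔ a = b := by
    intro T a b
    rw [holds_comp_char, equalizerSubobject_factors_iff, lift_fst, lift_snd]
  -- `φ x` is the predicate `(x ∈ U → z = f x) ∧ (x ∈ V → z = g x)` on `z`; it is the singleton of
  -- `f x` on `U` and that of `g x` on `V`, so it factors through the singleton map
  let φ := MonoidalClosed.curry (char S)
  let sing := MonoidalClosed.curry (char δ)
  have : Mono sing := by
    constructor
    intro Y a b hab
    have := (comp_curry_eq_iff a b _ _).1 hab a (𝟙 Y)
    rw [hδ, hδ, Category.id_comp, Category.id_comp] at this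
    exact this.1 rfl
  have hUφ : ∀ {Y : C} (t : Y ⟶ X), U.Factors t → t ≫ φ = (t ≫ f) ≫ sing := by
    intro Y t ht
    refine (comp_curry_eq_iff _ _ _ _).2 fun z y => ?_
    rw [hδ, holds_comp_char, Subobject.inf_factors, himp, himp]
    constructor
    · rintro ⟨h, -⟩
      simpa using h (𝟙 _) (Subobject.factors_of_factors_right _
        (Subobject.factors_of_factors_right _ ht))
    · rintro rfl
      refine ⟨fun _ _ => by simp, fun s hs => ?_⟩
      have := hfg _ (Subobject.factors_of_factors_right s
        (Subobject.factors_of_factors_right y ht)) hs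
      simpa using this
  have hVφ : ∀ {Y : C} (t : Y ⟶ X), V.Factors t → t ≫ φ = (t ≫ g) ≫ sing := by
    intro Y t ht
    refine (comp_curry_eq_iff _ _ _ _).2 fun z y => ?_
    rw [hδ, holds_comp_char, Subobject.inf_factors, himp, himp]
    constructor
    · rintro ⟨-, h⟩
      simpa using h (𝟙 _) (Subobject.factors_of_factors_right _
        (Subobject.factors_of_factors_right _ ht))
    · rintro rfl
      refine ⟨fun s hs => ?_, fun _ _ => by simp⟩
      have := hfg _ hs (Subobject.factors_of_factors_right s
        (Subobject.factors_of_factors_right y ht))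
      simpa using this.symm
  have hW := hUV ((Subobject.pullback φ).obj (Subobject.mk sing))
    (subobject_le_of_factors fun t ht => by
      rw [pullback_factors_iff, hUφ t ht]
      exact (Subobject.mk_factors_iff _ _).2 ⟨_, rfl⟩)
    (subobject_le_of_factors fun t ht => by
      rw [pullback_factors_iff, hVφ t ht]
      exact (Subobject.mk_factors_iff _ _).2 ⟨_, rfl⟩)
  have h1 : ((Subobject.pullback φ).obj (Subobject.mk sing)).Factors (𝟙 X) := by
    rw [hW]; exact Subobject.top_factors _
  rw [pullback_factors_iff, Category.id_comp] at h1
  obtain ⟨k, hk⟩ : ∃ k : X ⟶ Z, k ≫ sing = φ :=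
    (Subobject.mk_factors_iff sing φ).1 h1
  refine ⟨k, fun t ht => ?_, fun t ht => ?_⟩
  · rw [← cancel_mono sing, Category.assoc, hk, hUφ t ht]
  · rw [← cancel_mono sing, Category.assoc, hk, hVφ t ht]

end Topos

/-! ### Generalized elements of the positive cone -/

section Order

variable {C : Type u} [Category.{v} C] [CartesianMonoidalCategory C] [BraidedCategory C]
  [HasFiniteLimits C] {R : C} [OrderedRingObj R]

namespace Pos

/-- The order on the generalized elements of `R₊` at a given stage. -/
instance (X : C) : PartialOrder (X ⟶ Pos R) where
  le i j := Le (i ≫ incl R) (j ≫ incl R)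
  le_refl i := OrderedRingObj.le_refl _
  le_trans i j k := OrderedRingObj.le_trans _ _ _
  le_antisymm i j h h' := (cancel_mono (incl R)).1 (OrderedRingObj.le_antisymm _ _ h h')

lemma le_def {X : C} {i j : X ⟶ Pos R} : i ≤ j ↔ Le (i ≫ incl R) (j ≫ incl R) := Iff.rfl

instance (X : C) : Zero (X ⟶ Pos R) := ⟨Pos.zero R X⟩

instance (X : C) : Add (X ⟶ Pos R) := ⟨Pos.add⟩

/-- Addition of the generalized elements of `R₊` at a given stage. -/
instance (X : C) : AddCommMonoid (X ⟶ Pos R) where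
  nsmul := nsmulRec
  add_assoc i j k := (cancel_mono (incl R)).1 (by
    change add (add i j) k ≫ _ = add i (add j k) ≫ _
    simp only [add, mk_incl, _root_.add_assoc])
  zero_add i := (cancel_mono (incl R)).1 (by
    change add (zero R X) i ≫ _ = _
    simp only [add, mk_incl, zero_incl, _root_.zero_add])
  add_zero i := (cancel_mono (incl R)).1 (by
    change add i (zero R X) ≫ _ = _
    simp only [add, mk_incl, zero_incl, _root_.add_zero])
  add_comm i j := (cancel_mono (incl R)).1 (by
    change add i j ≫ _ = add j i ≫ _
    simp only [add, mk_incl, _root_.add_comm])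

lemma zero_def (X : C) : Pos.zero R X = 0 := rfl

lemma add_incl {X : C} (i j : X ⟶ Pos R) : (i + j) ≫ incl R = i ≫ incl R + j ≫ incl R :=
  mk_incl _ (add_nonneg i j)

lemma comp_zero' {X Y : C} (u : Y ⟶ X) : u ≫ (0 : X ⟶ Pos R) = 0 := comp_zero u

lemma comp_add' {X Y : C} (u : Y ⟶ X) (i j : X ⟶ Pos R) : u ≫ (i + j) = u ≫ i + u ≫ j :=
  comp_add u i j

lemma comp_le {X Y : C} (u : Y ⟶ X) {i j : X ⟶ Pos R} (h : i ≤ j) : u ≫ i ≤ u ≫ j := by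
  rw [le_def, Category.assoc, Category.assoc]
  exact Le.comp u h

instance (X : C) : IsOrderedCancelAddMonoid (X ⟶ Pos R) where
  add_le_add_left i j h k := by
    rw [le_def, add_incl, add_incl, add_comm _ (k ≫ _), add_comm _ (k ≫ _)]
    exact OrderedRingObj.add_le_add _ _ _ h
  le_of_add_le_add_left k i j h := by
    rw [le_def, add_incl, add_incl] at h
    have := OrderedRingObj.add_le_add _ _ (-(k ≫ incl R)) h
    rwa [neg_add_cancel_left, neg_add_cancel_left] at this

instance (X : C) : CanonicallyOrderedAdd (X ⟶ Pos R) where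
  exists_add_of_le {i j} h := exists_add i j h
  le_self_add i j := le_add i j
  le_add_self i j := by rw [add_comm]; exact le_add i j

variable [MonoidalClosed C] [HasSubobjectClassifier C]

/-- Proof by cases on the order of two generalized elements of `R₊`. -/
lemma subobject_eq_top {X : C} (i j : X ⟶ Pos R) (W : Subobject X)
    (h₁ : ∀ {Y : C} (t : Y ⟶ X), t ≫ i ≤ t ≫ j → W.Factors t)
    (h₂ : ∀ {Y : C} (t : Y ⟶ X), t ≫ j ≤ t ≫ i → W.Factors t) : W = ⊤ := by
  refine subobject_eq_top_of_cover OrderedRingObj.le_total (lift (i ≫ incl R) (j ≫ incl R)) W ?_ ?_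
  · intro Y t ht
    refine h₁ t ?_
    rw [le_def, Le]
    rwa [comp_lift, ← Category.assoc, ← Category.assoc] at ht
  · intro Y t ht
    refine h₂ t ?_
    rw [le_def, Le]
    rw [pullback_factors_iff] at ht
    simpa [comp_lift] using ht

/-- Equality of morphisms can be checked by cases on the order of two generalized elements
of `R₊`. -/
lemma hom_ext {X Z : C} (i j : X ⟶ Pos R) {f g : X ⟶ Z}
    (h₁ : ∀ {Y : C} (t : Y ⟶ X), t ≫ i ≤ t ≫ j → t ≫ f = t ≫ g)
    (h₂ : ∀ {Y : C} (t : Y ⟶ X), t ≫ j ≤ t ≫ i → t ≫ f = t ≫ g) : f = g := by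
  have h := subobject_eq_top i j (equalizerSubobject f g)
    (fun t ht => (equalizerSubobject_factors_iff _ _ _).2 (h₁ t ht))
    (fun t ht => (equalizerSubobject_factors_iff _ _ _).2 (h₂ t ht))
  have := (equalizerSubobject_factors_iff f g (𝟙 X)).1 (h ▸ Subobject.top_factors _)
  simpa using this

/-- An inequality can be checked by cases on the order of two generalized elements of `R₊`. -/
lemma le_of_cases {X : C} (i j : X ⟶ Pos R) {k l : X ⟶ Pos R}
    (h₁ : ∀ {Y : C} (t : Y ⟶ X), t ≫ i ≤ t ≫ j → t ≫ k ≤ t ≫ l)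
    (h₂ : ∀ {Y : C} (t : Y ⟶ X), t ≫ j ≤ t ≫ i → t ≫ k ≤ t ≫ l) : k ≤ l := by
  have e : ∀ {Y : C} (t : Y ⟶ X), ((Subobject.pullback (lift (k ≫ incl R) (l ≫ incl R))).obj
      (OrderedRingObj.le (R := R))).Factors t ↔ t ≫ k ≤ t ≫ l := by
    intro Y t
    rw [pullback_factors_iff, comp_lift, le_def, Category.assoc, Category.assoc]
  have h := subobject_eq_top i j ((Subobject.pullback (lift (k ≫ incl R) (l ≫ incl R))).obj
      (OrderedRingObj.le (R := R)))
    (fun t ht => (e t).2 (h₁ t ht)) (fun t ht => (e t).2 (h₂ t ht))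
  have := (e (𝟙 X)).1 (h ▸ Subobject.top_factors _)
  simpa using this

/-- Gluing of two morphisms along the cover `i ≤ j ∨ j ≤ i`. -/
lemma exists_glue {X Z : C} (i j : X ⟶ Pos R) (f g : X ⟶ Z)
    (h : ∀ {Y : C} (t : Y ⟶ X), t ≫ i = t ≫ j → t ≫ f = t ≫ g) :
    ∃ k : X ⟶ Z, (∀ {Y : C} (t : Y ⟶ X), t ≫ i ≤ t ≫ j → t ≫ k = t ≫ f) ∧
      ∀ {Y : C} (t : Y ⟶ X), t ≫ j ≤ t ≫ i → t ≫ k = t ≫ g := by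
  let U (i j : X ⟶ Pos R) : Subobject X :=
    (Subobject.pullback (lift (i ≫ incl R) (j ≫ incl R))).obj (OrderedRingObj.le (R := R))
  have hU : ∀ (i j : X ⟶ Pos R) {Y : C} (t : Y ⟶ X), (U i j).Factors t ↔ t ≫ i ≤ t ≫ j := by
    intro i j Y t
    rw [pullback_factors_iff, comp_lift, le_def, Category.assoc, Category.assoc]
  obtain ⟨k, h₁, h₂⟩ := MooreTT.exists_glue (U i j) (U j i)
    (fun W h₁ h₂ => subobject_eq_top i j W
      (fun t ht => Subobject.factors_of_le t h₁ ((hU i j t).2 ht))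
      (fun t ht => Subobject.factors_of_le t h₂ ((hU j i t).2 ht))) f g
    (fun t h₁ h₂ => h t (le_antisymm ((hU i j t).1 h₁) ((hU j i t).1 h₂)))
  exact ⟨k, fun t ht => h₁ t ((hU i j t).2 ht), fun t ht => h₂ t ((hU j i t).2 ht)⟩

/-- The morphism which is `f` where `i ≤ j` and `g` where `j ≤ i`. -/
def glue {X Z : C} (i j : X ⟶ Pos R) (f g : X ⟶ Z)
    (h : ∀ {Y : C} (t : Y ⟶ X), t ≫ i = t ≫ j → t ≫ f = t ≫ g) : X ⟶ Z :=
  (exists_glue i j f g h).choose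

section

variable {X Y Z : C} (i j : X ⟶ Pos R) (f g : X ⟶ Z)
  (h : ∀ {Y : C} (t : Y ⟶ X), t ≫ i = t ≫ j → t ≫ f = t ≫ g) (t : Y ⟶ X)

lemma comp_glue_of_le (ht : t ≫ i ≤ t ≫ j) : t ≫ glue i j f g h = t ≫ f :=
  (exists_glue i j f g h).choose_spec.1 t ht

lemma comp_glue_of_ge (ht : t ≫ j ≤ t ≫ i) : t ≫ glue i j f g h = t ≫ g :=
  (exists_glue i j f g h).choose_spec.2 t ht

end

/-- Minima of generalized elements of `R₊` at a given stage. -/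
instance (X : C) : SemilatticeInf (X ⟶ Pos R) where
  inf i j := glue i j i j fun _ h => h
  inf_le_left i j := by
    refine le_of_cases i j (fun t ht => ?_) (fun t ht => ?_)
    · rw [comp_glue_of_le _ _ _ _ _ _ ht]
    · rw [comp_glue_of_ge _ _ _ _ _ _ ht]; exact ht
  inf_le_right i j := by
    refine le_of_cases i j (fun t ht => ?_) (fun t ht => ?_)
    · rw [comp_glue_of_le _ _ _ _ _ _ ht]; exact ht
    · rw [comp_glue_of_ge _ _ _ _ _ _ ht]
  le_inf k i j h₁ h₂ := by
    refine le_of_cases i j (fun t ht => ?_) (fun t ht => ?_)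
    · rw [comp_glue_of_le _ _ _ _ _ _ ht]; exact comp_le t h₁
    · rw [comp_glue_of_ge _ _ _ _ _ _ ht]; exact comp_le t h₂

lemma comp_inf_of_le {X Y : C} {t : Y ⟶ X} {i j : X ⟶ Pos R} (h : t ≫ i ≤ t ≫ j) :
    t ≫ (i ⊓ j) = t ≫ i :=
  comp_glue_of_le _ _ _ _ _ _ h

lemma comp_inf_of_ge {X Y : C} {t : Y ⟶ X} {i j : X ⟶ Pos R} (h : t ≫ j ≤ t ≫ i) :
    t ≫ (i ⊓ j) = t ≫ j :=
  comp_glue_of_ge _ _ _ _ _ _ h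

lemma comp_inf {X Y : C} (u : Y ⟶ X) (i j : X ⟶ Pos R) : u ≫ (i ⊓ j) = u ≫ i ⊓ u ≫ j := by
  refine hom_ext (u ≫ i) (u ≫ j) (fun t ht => ?_) (fun t ht => ?_)
  · rw [comp_inf_of_le ht, ← Category.assoc, ← Category.assoc]
    exact comp_inf_of_le (by simpa using ht)
  · rw [comp_inf_of_ge ht, ← Category.assoc, ← Category.assoc]
    exact comp_inf_of_ge (by simpa using ht)

lemma exists_inf_add {X : C} (i j : X ⟶ Pos R) : ∃ k, i ⊓ j + k = i := by
  obtain ⟨k, hk⟩ := exists_add (i ⊓ j) i (inf_le_left (a := i))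
  exact ⟨k, hk.symm⟩

/-- Truncated subtraction of generalized elements of `R₊`, characterized by
`i = i ⊓ j + (i - j)`. -/
instance (X : C) : Sub (X ⟶ Pos R) where
  sub i j := (exists_inf_add i j).choose

lemma inf_add_tsub {X : C} (i j : X ⟶ Pos R) : i ⊓ j + (i - j) = i :=
  (exists_inf_add i j).choose_spec

lemma comp_tsub {X Y : C} (u : Y ⟶ X) (i j : X ⟶ Pos R) : u ≫ (i - j) = u ≫ i - u ≫ j := by
  have h := congrArg (fun z => u ≫ z) (inf_add_tsub i j)
  rw [comp_add', comp_inf] at h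
  exact add_left_cancel (h.trans (inf_add_tsub (u ≫ i) (u ≫ j)).symm)

instance (X : C) : OrderedSub (X ⟶ Pos R) where
  tsub_le_iff_right i j l := by
    constructor
    · intro h
      calc i = i ⊓ j + (i - j) := (inf_add_tsub i j).symm
        _ ≤ j + l := add_le_add inf_le_right h
        _ = l + j := add_comm _ _
    · intro h
      refine le_of_cases i j (fun t ht => ?_) (fun t ht => ?_)
      · have := inf_add_tsub (t ≫ i) (t ≫ j)
        rw [inf_eq_left.2 ht, add_eq_left] at this
        rw [comp_tsub, this]; exact zero_le
      · have h1 := comp_le t h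
        rw [← inf_add_tsub (t ≫ i) (t ≫ j), inf_eq_right.2 ht, comp_add', add_comm] at h1
        rw [comp_tsub]
        exact le_of_add_le_add_right h1

end Pos

end Order

/-! ### Operations on Moore paths -/

namespace MPath

section

variable {C : Type u} [Category.{v} C] [CartesianMonoidalCategory C] [BraidedCategory C]
  [HasFiniteLimits C] {R : C} [OrderedRingObj R] {X Y Γ Δ : C}

/-- The value `p j` of a path at a generalized element `j` of `R₊`, at a later stage `t`. -/
def ev (p : MPath R X Γ) (t : Y ⟶ X) (j : Y ⟶ Pos R) : Y ⟶ Γ := lift j t ≫ p.fn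

lemma lift_fn (p : MPath R X Γ) (t : Y ⟶ X) (j : Y ⟶ Pos R) : lift j t ≫ p.fn = p.ev t j := rfl

lemma ev_snd_fst (p : MPath R X Γ) : p.ev (snd _ _) (fst _ _) = p.fn := by simp [ev]

lemma comp_ev {Z : C} (p : MPath R X Γ) (s : Z ⟶ Y) (t : Y ⟶ X) (j : Y ⟶ Pos R) :
    s ≫ p.ev t j = p.ev (s ≫ t) (s ≫ j) := by
  simp [ev, comp_lift_assoc]

lemma ev_zero (p : MPath R X Γ) (t : Y ⟶ X) : p.ev t 0 = t ≫ p.src := by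
  rw [← p.at_zero, lift_fn, comp_ev, Category.comp_id, Pos.zero_def, Pos.comp_zero']

lemma ev_of_le (p : MPath R X Γ) {t : Y ⟶ X} {j : Y ⟶ Pos R} (h : t ≫ p.shape ≤ j) :
    p.ev t j = t ≫ p.tgt :=
  p.at_ge t j (by rw [Pos.le_def, Category.assoc] at h; exact h)

lemma ev_shape (p : MPath R X Γ) (t : Y ⟶ X) : p.ev t (t ≫ p.shape) = t ≫ p.tgt :=
  p.ev_of_le le_rfl

lemma ext_fn {p q : MPath R X Γ} (h₁ : p.shape = q.shape) (h₂ : p.fn = q.fn) : p = q := by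
  refine MPath.ext ?_ ?_ h₂ h₁
  · rw [← p.at_zero, ← q.at_zero, h₂]
  · have a := p.ev_shape (𝟙 X)
    have b := q.ev_shape (𝟙 X)
    rw [Category.id_comp, Category.id_comp] at a b
    rw [← a, ← b, h₁, ev, ev, h₂]

/-- A path is determined by its shape and its values at all later stages; its ends are its values at
`0` and at its shape. -/
lemma ext_ev {p q : MPath R X Γ} (h₁ : p.shape = q.shape)
    (h₂ : ∀ {Y : C} (t : Y ⟶ X) (j : Y ⟶ Pos R), p.ev t j = q.ev t j) : p = q :=
  ext_fn h₁ (by rw [← ev_snd_fst p, h₂, ev_snd_fst])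

@[simp] lemma restrict_ev {Z : C} (p : MPath R X Γ) (t : Y ⟶ X) (s : Z ⟶ Y) (j : Z ⟶ Pos R) :
    (p.restrict t).ev s j = p.ev (s ≫ t) j := by
  simp [ev, lift_whiskerLeft_assoc]

@[simp] lemma map_ev (p : MPath R X Γ) (γ : Γ ⟶ Δ) (t : Y ⟶ X) (j : Y ⟶ Pos R) :
    (p.map γ).ev t j = p.ev t j ≫ γ := by
  simp [ev]

@[simp] lemma idp_ev (x : X ⟶ Γ) (t : Y ⟶ X) (j : Y ⟶ Pos R) : (idp R x).ev t j = t ≫ x := by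
  simp [ev]

lemma restrict_id (p : MPath R X Γ) : p.restrict (𝟙 X) = p :=
  ext_ev (by simp) (by simp)

lemma restrict_restrict {Z : C} (p : MPath R X Γ) (t : Y ⟶ X) (s : Z ⟶ Y) :
    (p.restrict t).restrict s = p.restrict (s ≫ t) :=
  ext_ev (by simp) (by simp)

lemma restrict_idp (x : X ⟶ Γ) (t : Y ⟶ X) : (idp R x).restrict t = idp R (t ≫ x) :=
  ext_ev (by simp) (by simp)

end

variable {C : Type u} [Category.{v} C] [CartesianMonoidalCategory C] [BraidedCategory C]
  [HasFiniteLimits C] [MonoidalClosed C] [HasSubobjectClassifier C]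
  {R : C} [OrderedRingObj R] {X Y Γ Δ : C}

/-- The initial part of a path up to `i`: it has shape `i ⊓ |p|` and agrees with `p` up to `i`. -/
@[simps] def trunc (p : MPath R X Γ) (i : X ⟶ Pos R) : MPath R X Γ where
  src := p.src
  tgt := p.ev (𝟙 X) i
  fn := p.ev (snd _ _) (fst _ _ ⊓ snd _ _ ≫ i)
  shape := i ⊓ p.shape
  at_zero := by
    rw [comp_ev, Pos.comp_inf, lift_fst, lift_snd, lift_snd_assoc, Pos.zero_def,
      inf_eq_left.2 zero_le, ev_zero, Category.id_comp]
  at_ge {Y} t j h := by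
    rw [comp_ev, comp_ev, Pos.comp_inf, lift_fst, lift_snd, lift_snd_assoc, Category.comp_id]
    replace h : t ≫ i ⊓ t ≫ p.shape ≤ j := by
      rw [← Pos.comp_inf, Pos.le_def, Category.assoc]; exact h
    refine Pos.hom_ext (t ≫ i) (t ≫ p.shape) (fun s hs => ?_) (fun s hs => ?_)
    · have h' := Pos.comp_le s h
      rw [Pos.comp_inf_of_le hs] at h'
      rw [comp_ev, comp_ev, Pos.comp_inf_of_ge h']
    · have h' := Pos.comp_le s h
      rw [Pos.comp_inf_of_ge hs] at h'
      rw [comp_ev, comp_ev, ev_of_le, ev_of_le]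
      · simpa using hs
      · rw [Pos.comp_inf]
        simpa using And.intro h' hs

@[simp] lemma trunc_ev (p : MPath R X Γ) (i : X ⟶ Pos R) (t : Y ⟶ X) (j : Y ⟶ Pos R) :
    (p.trunc i).ev t j = p.ev t (j ⊓ t ≫ i) := by
  rw [ev, trunc_fn, comp_ev, Pos.comp_inf, lift_fst, lift_snd, lift_snd_assoc]

lemma trunc_restrict (p : MPath R X Γ) (i : X ⟶ Pos R) (t : Y ⟶ X) :
    (p.trunc i).restrict t = (p.restrict t).trunc (t ≫ i) :=
  ext_ev (by simp [Pos.comp_inf]) (by simp)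

lemma trunc_zero (p : MPath R X Γ) : p.trunc 0 = idp R p.src :=
  ext_ev (by simp [Pos.zero_def]) (fun t j => by
    rw [trunc_ev, Pos.comp_zero', inf_eq_right.2 zero_le, ev_zero, idp_ev])

lemma trunc_of_le (p : MPath R X Γ) {i : X ⟶ Pos R} (h : p.shape ≤ i) : p.trunc i = p :=
  ext_ev (by simpa using h) (fun t j => by
    rw [trunc_ev]
    have h' := Pos.comp_le t h
    refine Pos.hom_ext j (t ≫ i) (fun s hs => ?_) (fun s hs => ?_)
    · rw [comp_ev, comp_ev, Pos.comp_inf_of_le hs]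
    · have h'' := Pos.comp_le s h'
      rw [comp_ev, comp_ev, Pos.comp_inf_of_ge hs, ev_of_le, ev_of_le]
      · simpa using h''.trans hs
      · simpa using h'')

/-- The final part of a path from `i` on. -/
@[simps] def drop (p : MPath R X Γ) (i : X ⟶ Pos R) : MPath R X Γ where
  src := p.ev (𝟙 X) i
  tgt := p.tgt
  fn := p.ev (snd _ _) (snd _ _ ≫ i + fst _ _)
  shape := p.shape - i
  at_zero := by
    rw [comp_ev, Pos.comp_add', lift_fst, lift_snd, lift_snd_assoc, Pos.zero_def, add_zero,
      Category.id_comp]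
  at_ge {Y} t j h := by
    rw [comp_ev, Pos.comp_add', lift_fst, lift_snd, lift_snd_assoc]
    replace h : t ≫ p.shape - t ≫ i ≤ j := by
      rw [← Pos.comp_tsub, Pos.le_def, Category.assoc]; exact h
    exact p.ev_of_le (tsub_le_iff_left.1 h)

@[simp] lemma drop_ev (p : MPath R X Γ) (i : X ⟶ Pos R) (t : Y ⟶ X) (j : Y ⟶ Pos R) :
    (p.drop i).ev t j = p.ev t (t ≫ i + j) := by
  rw [ev, drop_fn, comp_ev, Pos.comp_add', lift_fst, lift_snd, lift_snd_assoc]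

lemma drop_restrict (p : MPath R X Γ) (i : X ⟶ Pos R) (t : Y ⟶ X) :
    (p.drop i).restrict t = (p.restrict t).drop (t ≫ i) :=
  ext_ev (by simp [Pos.comp_tsub]) (by simp)

lemma drop_map (p : MPath R X Γ) (i : X ⟶ Pos R) (γ : Γ ⟶ Δ) :
    (p.drop i).map γ = (p.map γ).drop i :=
  ext_ev (by simp) (by simp)

lemma drop_zero (p : MPath R X Γ) : p.drop 0 = p :=
  ext_ev (by simp) (fun t j => by rw [drop_ev, Pos.comp_zero', zero_add])

lemma drop_of_le (p : MPath R X Γ) {i : X ⟶ Pos R} (h : p.shape ≤ i) :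
    p.drop i = idp R p.tgt :=
  ext_ev (tsub_eq_zero_of_le h) (fun t j => by
    rw [drop_ev, idp_ev]
    exact p.ev_of_le ((Pos.comp_le t h).trans le_self_add))

/-- The reverse of a path. -/
@[simps] def rev (p : MPath R X Γ) : MPath R X Γ where
  src := p.tgt
  tgt := p.src
  fn := p.ev (snd _ _) (snd _ _ ≫ p.shape - fst _ _)
  shape := p.shape
  at_zero := by
    rw [comp_ev, Pos.comp_tsub, lift_fst, lift_snd, lift_snd_assoc, Pos.zero_def, tsub_zero,
      ev_shape, Category.id_comp]
  at_ge {Y} t j h := by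
    rw [comp_ev, Pos.comp_tsub, lift_fst, lift_snd, lift_snd_assoc]
    replace h : t ≫ p.shape ≤ j := by
      rw [Pos.le_def, Category.assoc]; exact h
    rw [tsub_eq_zero_of_le h, ev_zero]

@[simp] lemma rev_ev (p : MPath R X Γ) (t : Y ⟶ X) (j : Y ⟶ Pos R) :
    p.rev.ev t j = p.ev t (t ≫ p.shape - j) := by
  rw [ev, rev_fn, comp_ev, Pos.comp_tsub, lift_fst, lift_snd, lift_snd_assoc]

lemma rev_restrict (p : MPath R X Γ) (t : Y ⟶ X) : p.rev.restrict t = (p.restrict t).rev :=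
  ext_ev (by simp) (by simp)

lemma rev_comp {V : C} (p : MPath R X Γ) {π : Γ ⟶ V} {v : X ⟶ V}
    (h : p.fn ≫ π = snd _ _ ≫ v) : p.rev.fn ≫ π = snd _ _ ≫ v := by
  rw [rev_fn, ev, Category.assoc, h, lift_snd_assoc]

lemma concat_aux (p q : MPath R X Γ) (h : p.tgt = q.src) (t : Y ⟶ Pos R ⊗ X)
    (ht : t ≫ fst _ _ = t ≫ snd _ _ ≫ p.shape) :
    t ≫ p.fn = t ≫ q.ev (snd _ _) (fst _ _ - snd _ _ ≫ p.shape) := by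
  rw [comp_ev, Pos.comp_tsub, ht, tsub_self, ev_zero, ← h, ← p.ev_snd_fst, comp_ev]
  exact p.ev_of_le (by simp [ht])

/-- The concatenation of two paths. -/
@[simps] def concat (p q : MPath R X Γ) (h : p.tgt = q.src) : MPath R X Γ where
  src := p.src
  tgt := q.tgt
  fn := Pos.glue (fst _ _) (snd _ _ ≫ p.shape) p.fn
    (q.ev (snd _ _) (fst _ _ - snd _ _ ≫ p.shape)) (concat_aux p q h)
  shape := p.shape + q.shape
  at_zero := by
    rw [Pos.comp_glue_of_le, p.at_zero]
    rw [lift_fst, Pos.zero_def]; exact zero_le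
  at_ge {Y} t j h := by
    replace h : t ≫ p.shape + t ≫ q.shape ≤ j := by
      rw [← Pos.comp_add', Pos.le_def, Category.assoc]; exact h
    rw [Pos.comp_glue_of_ge, comp_ev, Pos.comp_tsub, lift_fst, lift_snd, lift_snd_assoc]
    · exact q.ev_of_le (le_tsub_of_add_le_left h)
    · rw [lift_fst, lift_snd_assoc]; exact le_self_add.trans h

section

variable (p q : MPath R X Γ) (h : p.tgt = q.src)

lemma concat_ev_of_le (t : Y ⟶ X) (j : Y ⟶ Pos R) (hj : j ≤ t ≫ p.shape) :
    (p.concat q h).ev t j = p.ev t j := by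
  rw [ev, concat_fn, Pos.comp_glue_of_le, lift_fn]
  rwa [lift_fst, lift_snd_assoc]

lemma concat_ev_of_ge (t : Y ⟶ X) (j : Y ⟶ Pos R) (hj : t ≫ p.shape ≤ j) :
    (p.concat q h).ev t j = q.ev t (j - t ≫ p.shape) := by
  rw [ev, concat_fn, Pos.comp_glue_of_ge, comp_ev, Pos.comp_tsub, lift_fst, lift_snd,
    lift_snd_assoc]
  rwa [lift_fst, lift_snd_assoc]

lemma concat_restrict (t : Y ⟶ X) :
    (p.concat q h).restrict t = (p.restrict t).concat (q.restrict t) (by simp [h]) := by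
  refine ext_ev (by simp [Pos.comp_add']) (fun s j => ?_)
  refine Pos.hom_ext j (s ≫ t ≫ p.shape) (fun r hr => ?_) (fun r hr => ?_)
  · rw [comp_ev, comp_ev, concat_ev_of_le, restrict_ev, restrict_ev, concat_ev_of_le] <;>
      simpa using hr
  · rw [comp_ev, comp_ev, concat_ev_of_ge, restrict_ev, restrict_ev, concat_ev_of_ge]
    · simp
    · simpa using hr
    · simpa using hr

lemma concat_comp {V : C} (π : Γ ⟶ V) (v : X ⟶ V) (hp : p.fn ≫ π = snd _ _ ≫ v)
    (hq : q.fn ≫ π = snd _ _ ≫ v) : (p.concat q h).fn ≫ π = snd _ _ ≫ v := by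
  refine Pos.hom_ext (fst _ _) (snd _ _ ≫ p.shape) (fun r hr => ?_) (fun r hr => ?_)
  · rw [concat_fn, ← Category.assoc, Pos.comp_glue_of_le _ _ _ _ _ _ hr, Category.assoc, hp]
  · rw [concat_fn, ← Category.assoc, Pos.comp_glue_of_ge _ _ _ _ _ _ hr, ev]
    simp only [Category.assoc, hq, lift_snd_assoc]

/-- Concatenation has strict units. -/
lemma concat_of_shape_left (hp : p.shape = 0) : p.concat q h = q := by
  refine ext_ev (by simp [hp]) (fun t j => ?_)
  rw [concat_ev_of_ge, hp, Pos.comp_zero', tsub_zero]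
  rw [hp, Pos.comp_zero']; exact zero_le

lemma concat_of_shape_right (hq : q.shape = 0) : p.concat q h = p := by
  refine ext_ev (by simp [hq]) (fun t j => ?_)
  refine Pos.hom_ext j (t ≫ p.shape) (fun r hr => ?_) (fun r hr => ?_)
  · rw [comp_ev, comp_ev, concat_ev_of_le]; simpa using hr
  · have hr' : (r ≫ t) ≫ p.shape ≤ r ≫ j := by simpa using hr
    rw [comp_ev, comp_ev, concat_ev_of_ge _ _ _ _ _ hr', ev_of_le q, ev_of_le p hr']
    · rw [h, ← ev_zero q, ev_of_le q]; rw [hq, Pos.comp_zero']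
    · rw [hq, Pos.comp_zero']; exact zero_le

end

end MPath

/-! ### Transport of paths in the fibres of a family -/

section

variable {C : Type u} [Category.{v} C] [CartesianMonoidalCategory C] [BraidedCategory C]
  [HasFiniteLimits C] {R : C} [OrderedRingObj R]

lemma MPath.src_comp_of_fn_comp {X Γ V : C} (p : MPath R X Γ) {π : Γ ⟶ V} {v : X ⟶ V}
    (h : p.fn ≫ π = snd _ _ ≫ v) : p.src ≫ π = v := by
  rw [← p.at_zero, Category.assoc, h, lift_snd_assoc, Category.id_comp]

lemma MPath.tgt_comp_of_fn_comp {X Γ V : C} (p : MPath R X Γ) {π : Γ ⟶ V} {v : X ⟶ V}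
    (h : p.fn ≫ π = snd _ _ ≫ v) : p.tgt ≫ π = v := by
  have := p.ev_shape (𝟙 X)
  rw [Category.id_comp, Category.id_comp] at this
  rw [← this, MPath.ev, Category.assoc, h, lift_snd_assoc, Category.id_comp]

variable {Γ Δ : C} {A : Fam Γ}

lemma Tap.tr_congr (s : Tap R A) {X : C} {p p' : MPath R X Γ} {a a' : X ⟶ A.tot} (hp : p = p')
    (ha : a = a') (h : a ≫ A.proj = p.src ≫ A.name) :
    s.tr p a h = s.tr p' a' (by rw [← hp, ← ha, h]) := by
  subst hp ha; rfl

/-- The path `α` in the total object of the family `A` lies over the path `γ` and has the same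
shape; together they form a path in `Γ.A`. -/
structure LiesOver {Γ : C} (A : Fam Γ) {X : C} (γ : MPath R X Γ) (α : MPath R X A.tot) :
    Prop where
  fn_proj : α.fn ≫ A.proj = γ.fn ≫ A.name
  shape_eq : α.shape = γ.shape

namespace LiesOver

variable {X Y : C} {γ : MPath R X Γ} {α : MPath R X A.tot}

lemma ev_proj (h : LiesOver A γ α) (t : Y ⟶ X) (j : Y ⟶ Pos R) :
    α.ev t j ≫ A.proj = γ.ev t j ≫ A.name := by
  rw [MPath.ev, MPath.ev, Category.assoc, Category.assoc, h.fn_proj]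

lemma src_proj (h : LiesOver A γ α) : α.src ≫ A.proj = γ.src ≫ A.name := by
  have := h.ev_proj (𝟙 X) 0
  simpa [MPath.ev_zero] using this

lemma restrict (h : LiesOver A γ α) (t : Y ⟶ X) :
    LiesOver A (γ.restrict t) (α.restrict t) where
  fn_proj := by
    rw [MPath.restrict_fn, MPath.restrict_fn, Category.assoc, Category.assoc, h.fn_proj]
  shape_eq := by rw [MPath.restrict_shape, MPath.restrict_shape, h.shape_eq]

lemma map {A : Fam Γ} (σ : Δ ⟶ Γ) {γ : MPath R X Δ} {α : MPath R X A.tot}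
    (h : LiesOver (A.sub σ) γ α) : LiesOver A (γ.map σ) α where
  fn_proj := h.fn_proj.trans (Category.assoc _ _ _).symm
  shape_eq := h.shape_eq

end LiesOver

lemma Tap.push_cond {X Y : C} {γ : MPath R X Γ} {q : MPath R X A.tot} (hq : q.fn ≫ A.proj = snd _ _ ≫ γ.src ≫ A.name)
    (t : Y ⟶ X) (j : Y ⟶ Pos R) : q.ev t j ≫ A.proj = (γ.restrict t).src ≫ A.name := by
  rw [MPath.ev, Category.assoc, hq, lift_snd_assoc, MPath.restrict_src, Category.assoc]

/-- Naturality in the stage of transport of the values of a path in a fibre. -/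
lemma Tap.comp_tr_push (s : Tap R A) {X Y Z : C} {γ : MPath R X Γ} {q : MPath R X A.tot}
    (hq : q.fn ≫ A.proj = snd _ _ ≫ γ.src ≫ A.name) (r : Z ⟶ Y) (t : Y ⟶ X) (j : Y ⟶ Pos R) :
    r ≫ s.tr (γ.restrict t) (q.ev t j) (push_cond hq t j) =
      s.tr (γ.restrict (r ≫ t)) (q.ev (r ≫ t) (r ≫ j)) (push_cond hq _ _) := by
  rw [← s.tr_restrict]
  exact s.tr_congr (MPath.restrict_restrict _ _ _) (q.comp_ev r t j) _

namespace Tap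

variable (s : Tap R A) {X Y : C} {γ : MPath R X Γ}

/-- The image of a path in the fibre `A x` under transport along `γ : x ∼ y`. -/
@[simps] def push (γ : MPath R X Γ) (q : MPath R X A.tot)
    (hq : q.fn ≫ A.proj = snd _ _ ≫ γ.src ≫ A.name) : MPath R X A.tot where
  src := s.tr γ q.src (q.src_comp_of_fn_comp hq)
  tgt := s.tr γ q.tgt (q.tgt_comp_of_fn_comp hq)
  fn := s.tr (γ.restrict (snd _ _)) (q.ev (snd _ _) (fst _ _)) (push_cond hq _ _)
  shape := q.shape
  at_zero := by
    rw [comp_tr_push _ hq]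
    refine s.tr_congr ?_ ?_ _
    · rw [lift_snd, MPath.restrict_id]
    · rw [lift_snd, lift_fst, Pos.zero_def, MPath.ev_zero, Category.id_comp]
  at_ge {Y} t j hj := by
    replace hj : t ≫ q.shape ≤ j := by rw [Pos.le_def, Category.assoc]; exact hj
    rw [comp_tr_push _ hq, ← s.tr_restrict]
    exact s.tr_congr (by rw [lift_snd]) (by rw [lift_snd, lift_fst, MPath.ev_of_le _ hj]) _

lemma push_ev {q : MPath R X A.tot} (hq : q.fn ≫ A.proj = snd _ _ ≫ γ.src ≫ A.name)
    (t : Y ⟶ X) (j : Y ⟶ Pos R) :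
    (s.push γ q hq).ev t j = s.tr (γ.restrict t) (q.ev t j) (push_cond hq t j) := by
  rw [MPath.ev, push_fn, comp_tr_push _ hq]
  exact s.tr_congr (by rw [lift_snd]) (by rw [lift_snd, lift_fst]) _

lemma push_restrict {q : MPath R X A.tot} (hq : q.fn ≫ A.proj = snd _ _ ≫ γ.src ≫ A.name)
    (t : Y ⟶ X) (hq' : (q.restrict t).fn ≫ A.proj = snd _ _ ≫ (γ.restrict t).src ≫ A.name) :
    (s.push γ q hq).restrict t = s.push (γ.restrict t) (q.restrict t) hq' :=
  MPath.ext_ev rfl (fun r j => by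
    rw [MPath.restrict_ev, push_ev, push_ev]
    exact s.tr_congr (by rw [MPath.restrict_restrict]) (by rw [MPath.restrict_ev]) _)

lemma push_sub {A : Fam Γ} (s : Tap R A) (σ : Δ ⟶ Γ) {γ : MPath R X Δ} {q : MPath R X A.tot}
    (hq : q.fn ≫ (A.sub σ).proj = snd _ _ ≫ γ.src ≫ (A.sub σ).name)
    (hq' : q.fn ≫ A.proj = snd _ _ ≫ (γ.map σ).src ≫ A.name) :
    (s.sub σ).push γ q hq = s.push (γ.map σ) q hq' :=
  MPath.ext_ev rfl (fun r j => by
    refine ((s.sub σ).push_ev hq r j).trans (Eq.trans ?_ (s.push_ev hq' r j).symm)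
    exact s.tr_congr (MPath.map_restrict _ _ _) rfl _)

lemma push_comp {q : MPath R X A.tot} (hq : q.fn ≫ A.proj = snd _ _ ≫ γ.src ≫ A.name) :
    (s.push γ q hq).fn ≫ A.proj = snd _ _ ≫ γ.tgt ≫ A.name := by
  rw [push_fn, s.tr_proj, MPath.restrict_tgt, Category.assoc]

lemma push_idp {x : X ⟶ Γ} {q : MPath R X A.tot}
    (hq : q.fn ≫ A.proj = snd _ _ ≫ (MPath.idp R x).src ≫ A.name) :
    s.push (MPath.idp R x) q hq = q :=
  MPath.ext_ev rfl (fun r j => by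
    rw [push_ev]
    exact (s.tr_congr (MPath.restrict_idp _ _) rfl _).trans (s.tr_idp _ _ _))

end Tap

variable [MonoidalClosed C]

section PathObject

variable {E V X Y : C} {π : E ⟶ V}

/-- The generalized element of the path object corresponding to a path in a fibre of `π`. -/
def ofPath (p : MPath R X E) (hp : p.fn ≫ π = snd _ _ ≫ p.src ≫ π) : X ⟶ pathObj R π :=
  (existsUnique_pathObj π p hp).choose

@[simp] lemma toPath_ofPath (p : MPath R X E) (hp : p.fn ≫ π = snd _ _ ≫ p.src ≫ π) :
    toPath (ofPath p hp) = p :=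
  (existsUnique_pathObj π p hp).choose_spec.1

lemma toPath_injective {m n : X ⟶ pathObj R π} (h : toPath m = toPath n) : m = n :=
  (existsUnique_pathObj π (toPath n) (toPath_fiber n)).unique h rfl

lemma toPath_comp (t : Y ⟶ X) (m : X ⟶ pathObj R π) : toPath (t ≫ m) = (toPath m).restrict t := by
  rw [toPath, toPath, MPath.restrict_restrict]

end PathObject

variable [HasSubobjectClassifier C]

lemma MPath.concat_congr {X Γ : C} {p p' q q' : MPath R X Γ}
    (hp : p = p') (hq : q = q') (h : p.tgt = q.src) (h' : p'.tgt = q'.src) :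
    p.concat q h = p'.concat q' h' := by
  subst hp hq; rfl

namespace Tap

variable (s : Tap R A) {X Y : C} {γ : MPath R X Γ}

lemma drag_cond {α : MPath R X A.tot} (h : LiesOver A γ α) (t : Y ⟶ X) (j : Y ⟶ Pos R) :
    α.ev t j ≫ A.proj = ((γ.restrict t).drop j).src ≫ A.name := by
  rw [h.ev_proj, MPath.drop_src, MPath.restrict_ev, Category.id_comp]

/-- Naturality in the stage of transport along the final parts of a path. -/
lemma comp_tr_drop {Z : C} {α : MPath R X A.tot} (h : LiesOver A γ α) (r : Z ⟶ Y) (t : Y ⟶ X)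
    (j : Y ⟶ Pos R) :
    r ≫ s.tr ((γ.restrict t).drop j) (α.ev t j) (drag_cond h t j) =
      s.tr ((γ.restrict (r ≫ t)).drop (r ≫ j)) (α.ev (r ≫ t) (r ≫ j)) (drag_cond h _ _) := by
  rw [← s.tr_restrict]
  exact s.tr_congr (by rw [MPath.drop_restrict, MPath.restrict_restrict]) (α.comp_ev r t j) _

/-- A path in `Γ.A` over `γ : x ∼ y` from `(x, a)` to `(y, b)` yields the path
`γ_* a ∼ b` in `A y` which at `j` is the transport of `α j` along the part of `γ` from `j` on. -/
@[simps] def drag {α : MPath R X A.tot} (h : LiesOver A γ α) : MPath R X A.tot where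
  src := s.tr γ α.src h.src_proj
  tgt := α.tgt
  fn := s.tr ((γ.restrict (snd _ _)).drop (fst _ _)) (α.ev (snd _ _) (fst _ _)) (drag_cond h _ _)
  shape := γ.shape
  at_zero := by
    rw [comp_tr_drop _ h]
    refine s.tr_congr ?_ ?_ _
    · rw [lift_snd, lift_fst, Pos.zero_def, MPath.drop_zero, MPath.restrict_id]
    · rw [lift_snd, lift_fst, Pos.zero_def, MPath.ev_zero, Category.id_comp]
  at_ge {Y} t j hj := by
    replace hj : t ≫ γ.shape ≤ j := by rw [Pos.le_def, Category.assoc]; exact hj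
    rw [comp_tr_drop _ h]
    refine (s.tr_congr (p' := MPath.idp R (t ≫ γ.tgt)) (a' := t ≫ α.tgt) ?_ ?_ _).trans
      (s.tr_idp _ _ _)
    · rw [lift_snd, lift_fst, MPath.drop_of_le _ hj, MPath.restrict_tgt]
    · rw [lift_snd, lift_fst, MPath.ev_of_le]
      rwa [h.shape_eq]

lemma drag_ev {α : MPath R X A.tot} (h : LiesOver A γ α) (t : Y ⟶ X) (j : Y ⟶ Pos R) :
    (s.drag h).ev t j = s.tr ((γ.restrict t).drop j) (α.ev t j) (drag_cond h t j) := by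
  rw [MPath.ev, drag_fn, comp_tr_drop _ h]
  exact s.tr_congr (by rw [lift_snd, lift_fst]) (by rw [lift_snd, lift_fst]) _

lemma drag_restrict {α : MPath R X A.tot} (h : LiesOver A γ α) (t : Y ⟶ X) :
    (s.drag h).restrict t = s.drag (h.restrict t) :=
  MPath.ext_ev rfl (fun r j => by
    rw [MPath.restrict_ev, drag_ev, drag_ev]
    exact s.tr_congr (by rw [MPath.restrict_restrict]) (by rw [MPath.restrict_ev]) _)

lemma drag_sub {A : Fam Γ} (s : Tap R A) (σ : Δ ⟶ Γ) {γ : MPath R X Δ} {α : MPath R X A.tot}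
    (h : LiesOver (A.sub σ) γ α) : (s.sub σ).drag h = s.drag h.map :=
  MPath.ext_ev rfl (fun r j => by
    refine ((s.sub σ).drag_ev h r j).trans (Eq.trans ?_ (s.drag_ev h.map r j).symm)
    exact s.tr_congr (by rw [MPath.drop_map, MPath.map_restrict]) rfl _)

lemma drag_comp {α : MPath R X A.tot} (h : LiesOver A γ α) :
    (s.drag h).fn ≫ A.proj = snd _ _ ≫ γ.tgt ≫ A.name := by
  rw [drag_fn, s.tr_proj, MPath.drop_tgt, MPath.restrict_tgt, Category.assoc]

lemma rev_drag_tgt {α : MPath R X A.tot} (h : LiesOver A γ α) {q : MPath R X A.tot}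
    (hq : q.fn ≫ A.proj = snd _ _ ≫ γ.src ≫ A.name) (hs : q.src = α.src) :
    (s.drag h).rev.tgt = (s.push γ q hq).src :=
  s.tr_congr rfl hs.symm _

lemma push_tgt_eq {α : MPath R X A.tot} (h : LiesOver A γ α) {q : MPath R X A.tot}
    (hq : q.fn ≫ A.proj = snd _ _ ≫ γ.src ≫ A.name) (ht : q.tgt = α.src) :
    (s.push γ q hq).tgt = (s.drag h).src :=
  s.tr_congr rfl ht _

/-- Transport of paths in the fibres of `A`: the conjugate of the image of `q : a₁ ∼ a₂` under
transport along `γ : x ∼ y` by the paths `γ_* aᵢ ∼ bᵢ` in `A y` obtained from paths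
`(x, aᵢ) ∼ (y, bᵢ)` over `γ`. -/
def conj {α₁ α₂ : MPath R X A.tot} (h₁ : LiesOver A γ α₁) (h₂ : LiesOver A γ α₂)
    (q : MPath R X A.tot) (hq : q.fn ≫ A.proj = snd _ _ ≫ γ.src ≫ A.name)
    (hs : q.src = α₁.src) (ht : q.tgt = α₂.src) : MPath R X A.tot :=
  ((s.drag h₁).rev.concat (s.push γ q hq) (s.rev_drag_tgt h₁ hq hs)).concat (s.drag h₂)
    (s.push_tgt_eq h₂ hq ht)

section

variable {α₁ α₂ : MPath R X A.tot} (h₁ : LiesOver A γ α₁) (h₂ : LiesOver A γ α₂)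
    (q : MPath R X A.tot) (hq : q.fn ≫ A.proj = snd _ _ ≫ γ.src ≫ A.name)
    (hs : q.src = α₁.src) (ht : q.tgt = α₂.src)

lemma conj_comp :
    (s.conj h₁ h₂ q hq hs ht).fn ≫ A.proj = snd _ _ ≫ γ.tgt ≫ A.name :=
  MPath.concat_comp _ _ _ _ _
    (MPath.concat_comp _ _ _ _ _ (MPath.rev_comp _ (s.drag_comp h₁)) (s.push_comp hq)) (s.drag_comp h₂)

lemma conj_restrict (t : Y ⟶ X)
    (hq' : (q.restrict t).fn ≫ A.proj = snd _ _ ≫ (γ.restrict t).src ≫ A.name) :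
    (s.conj h₁ h₂ q hq hs ht).restrict t =
      s.conj (h₁.restrict t) (h₂.restrict t) (q.restrict t) hq' (by simp [hs]) (by simp [ht]) := by
  refine (MPath.concat_restrict _ _ _ t).trans (MPath.concat_congr
    ((MPath.concat_restrict _ _ _ t).trans (MPath.concat_congr ?_ ?_ _ _)) ?_ _ _)
  · rw [MPath.rev_restrict, drag_restrict]
  · exact s.push_restrict hq t hq'
  · exact s.drag_restrict h₂ t

lemma conj_sub {A : Fam Γ} (s : Tap R A) (σ : Δ ⟶ Γ) {γ : MPath R X Δ} {α₁ α₂ : MPath R X A.tot}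
    (h₁ : LiesOver (A.sub σ) γ α₁) (h₂ : LiesOver (A.sub σ) γ α₂) (q : MPath R X A.tot)
    (hq : q.fn ≫ (A.sub σ).proj = snd _ _ ≫ γ.src ≫ (A.sub σ).name)
    (hs : q.src = α₁.src) (ht : q.tgt = α₂.src)
    (hq' : q.fn ≫ A.proj = snd _ _ ≫ (γ.map σ).src ≫ A.name) :
    (s.sub σ).conj h₁ h₂ q hq hs ht = s.conj h₁.map h₂.map q hq' hs ht := by
  exact MPath.concat_congr (MPath.concat_congr (congrArg MPath.rev (s.drag_sub σ h₁))
    (s.push_sub σ hq hq') _ _) (s.drag_sub σ h₂) _ _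

lemma conj_of_idp {x : X ⟶ Γ} (hγ : γ = MPath.idp R x) : s.conj h₁ h₂ q hq hs ht = q := by
  subst hγ
  exact (MPath.concat_of_shape_right _ _ _ rfl).trans
    ((MPath.concat_of_shape_left _ _ _ rfl).trans (s.push_idp hq))

end

lemma conj_congr {γ γ' : MPath R X Γ} {α₁ α₂ α₁' α₂' q q' : MPath R X A.tot}
    {h₁ : LiesOver A γ α₁} {h₂ : LiesOver A γ α₂}
    {hq : q.fn ≫ A.proj = snd _ _ ≫ γ.src ≫ A.name} {hs : q.src = α₁.src} {ht : q.tgt = α₂.src}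
    {h₁' : LiesOver A γ' α₁'} {h₂' : LiesOver A γ' α₂'}
    {hq' : q'.fn ≫ A.proj = snd _ _ ≫ γ'.src ≫ A.name} {hs' : q'.src = α₁'.src}
    {ht' : q'.tgt = α₂'.src} (hγ : γ = γ') (e₁ : α₁ = α₁') (e₂ : α₂ = α₂') (e : q = q') :
    s.conj h₁ h₂ q hq hs ht = s.conj h₁' h₂' q' hq' hs' ht' := by
  subst hγ e₁ e₂ e; rfl

end Tap

end

/-! ### Morphisms into pullbacks -/

section

variable {C : Type u} [Category.{v} C] [HasPullbacks C] {Γ : C} {A : Fam Γ} {X : C}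

lemma comp_pullback_lift_eq_iff {E V Z W : C} {f : E ⟶ V} {a b : Z ⟶ E} {c d : W ⟶ E}
    (hab : a ≫ f = b ≫ f) (hcd : c ≫ f = d ≫ f) (m : X ⟶ Z) (n : X ⟶ W) :
    m ≫ pullback.lift a b hab = n ≫ pullback.lift c d hcd ↔ m ≫ a = n ≫ c ∧ m ≫ b = n ≫ d := by
  constructor
  · intro h
    have h₁ := congrArg (fun z => z ≫ pullback.fst f f) h
    have h₂ := congrArg (fun z => z ≫ pullback.snd f f) h
    simp only [Category.assoc, pullback.lift_fst, pullback.lift_snd] at h₁ h₂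
    exact ⟨h₁, h₂⟩
  · rintro ⟨h₁, h₂⟩
    apply pullback.hom_ext
    · simpa only [Category.assoc, pullback.lift_fst] using h₁
    · simpa only [Category.assoc, pullback.lift_snd] using h₂

/-- The generalized element `((x, a₁), a₂)` of `Γ.A.A p`. -/
def wkMk (n : X ⟶ A.cpr) (b : X ⟶ A.tot) (h : b ≫ A.proj = n ≫ A.p ≫ A.name) : X ⟶ A.wk.cpr :=
  pullback.lift n b h.symm

@[simp] lemma wkMk_p (n : X ⟶ A.cpr) (b : X ⟶ A.tot) (h : b ≫ A.proj = n ≫ A.p ≫ A.name) :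
    wkMk n b h ≫ A.wk.p = n := pullback.lift_fst _ _ _

@[simp] lemma wkMk_q (n : X ⟶ A.cpr) (b : X ⟶ A.tot) (h : b ≫ A.proj = n ≫ A.p ≫ A.name) :
    wkMk n b h ≫ A.wk.q = b := pullback.lift_snd _ _ _

end

section

variable {C : Type u} [Category.{v} C] [CartesianMonoidalCategory C] [BraidedCategory C]
  [HasFiniteLimits C] {R : C} [OrderedRingObj R]
  {Γ Δ : C} {A : Fam Γ} {X Y : C}

lemma liesOver_left (A : Fam Γ) (P : MPath R X A.wk.cpr) :
    LiesOver A ((P.map A.wk.p).map A.p) ((P.map A.wk.p).map A.q) where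
  fn_proj := by
    simp only [MPath.map_fn, Category.assoc]
    rw [pullback.condition]
  shape_eq := rfl

lemma liesOver_right (P : MPath R X A.wk.cpr) :
    LiesOver A ((P.map A.wk.p).map A.p) (P.map A.wk.q) where
  fn_proj := by
    have h : A.wk.q ≫ A.proj = A.wk.p ≫ A.p ≫ A.name :=
      (pullback.condition (f := A.wk.name) (g := A.wk.proj)).symm
    simp only [MPath.map_fn, Category.assoc]
    exact (Category.assoc _ _ _).trans (congrArg (fun z => P.fn ≫ z) h)
  shape_eq := rfl

variable [MonoidalClosed C]

/-- A generalized element of the path object lies over `((x, a₁), a₂)` when it is a path from `a₁`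
to `a₂`. -/
lemma comp_mooreId_proj_eq_iff (m : X ⟶ pathObj R A.proj) (n : X ⟶ A.wk.cpr) :
    m ≫ (mooreId R A).proj = n ≫ (mooreId R A).name ↔
      (toPath m).src = (n ≫ A.wk.p) ≫ A.q ∧ (toPath m).tgt = n ≫ A.wk.q := by
  rw [Category.assoc]
  exact comp_pullback_lift_eq_iff _ _ m n

/-! ### Generalized elements of `Γ.A.A p.Id_A` -/

lemma idLeft_comp (t : Y ⟶ X) (e : X ⟶ (mooreId R A).cpr) : idLeft (t ≫ e) = t ≫ idLeft e := by
  simp [idLeft]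

lemma idPath_comp (t : Y ⟶ X) (e : X ⟶ (mooreId R A).cpr) :
    idPath (t ≫ e) = (idPath e).restrict t := by
  exact (congrArg toPath (Category.assoc t e (mooreId R A).q)).trans
    (toPath_comp t (e ≫ (mooreId R A).q))

lemma idPath_src_tgt (e : X ⟶ (mooreId R A).cpr) :
    (idPath e).src = idLeft e ≫ A.q ∧ (idPath e).tgt = idRight e :=
  (comp_mooreId_proj_eq_iff _ _).1 ((Category.assoc _ _ _).trans
    ((congrArg (fun z => e ≫ z) pullback.condition.symm).trans (Category.assoc _ _ _).symm))

lemma idLeft_q_proj (e : X ⟶ (mooreId R A).cpr) :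
    (idLeft e ≫ A.q) ≫ A.proj = (idLeft e ≫ A.p) ≫ A.name := by
  rw [Category.assoc, Category.assoc]
  exact congrArg (fun z => idLeft e ≫ z) pullback.condition.symm

lemma idPath_comp_proj (e : X ⟶ (mooreId R A).cpr) :
    (idPath e).fn ≫ A.proj = snd _ _ ≫ (idLeft e ≫ A.p) ≫ A.name := by
  rw [← idLeft_q_proj, ← (idPath_src_tgt e).1]
  exact toPath_fiber _

/-- A generalized element `(((x, a₁), a₂), p)` is determined by `x` and `p`. -/
lemma id_hom_ext {e e' : X ⟶ (mooreId R A).cpr} (h₁ : idLeft e ≫ A.p = idLeft e' ≫ A.p)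
    (h₂ : idPath e = idPath e') : e = e' := by
  refine pullback.hom_ext (pullback.hom_ext (pullback.hom_ext ?_ ?_) ?_) (toPath_injective h₂)
  · exact h₁
  · exact (idPath_src_tgt e).1.symm.trans ((congrArg MPath.src h₂).trans (idPath_src_tgt e').1)
  · exact (idPath_src_tgt e).2.symm.trans ((congrArg MPath.tgt h₂).trans (idPath_src_tgt e').2)

section

variable (x : X ⟶ Γ) (p : MPath R X A.tot) (hp : p.fn ≫ A.proj = snd _ _ ≫ x ≫ A.name)

/-- The generalized element `((x, p 0), p |p|)` given by a path `p` in `A x`. -/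
def idEnds : X ⟶ A.wk.cpr :=
  wkMk (pullback.lift x p.src (p.src_comp_of_fn_comp hp).symm) p.tgt
    (by rw [p.tgt_comp_of_fn_comp hp, pullback.lift_fst_assoc])

lemma ofPath_proj (hp' : p.fn ≫ A.proj = snd _ _ ≫ p.src ≫ A.proj) :
    ofPath p hp' ≫ (mooreId R A).proj = idEnds x p hp ≫ (mooreId R A).name :=
  (comp_mooreId_proj_eq_iff _ _).2 (by
    rw [toPath_ofPath, idEnds, wkMk_p, wkMk_q, pullback.lift_snd]
    exact ⟨rfl, rfl⟩)

/-- The generalized element `(((x, p 0), p |p|), p)` given by a path `p` in `A x`. -/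
def idMk : X ⟶ (mooreId R A).cpr :=
  pullback.lift (idEnds x p hp) (ofPath p (by rw [p.src_comp_of_fn_comp hp, hp]))
    (ofPath_proj x p hp _).symm

@[simp] lemma idLeft_idMk_p : idLeft (idMk x p hp) ≫ A.p = x := by
  have h : idMk x p hp ≫ (mooreId R A).p = idEnds x p hp := pullback.lift_fst _ _ _
  rw [idLeft, h, idEnds, wkMk_p, pullback.lift_fst]

@[simp] lemma idPath_idMk : idPath (idMk x p hp) = p :=
  (congrArg toPath (pullback.lift_snd _ _ (ofPath_proj x p hp _).symm)).trans (toPath_ofPath p _)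

end

variable (R A) in
/-- The degenerate paths, as a morphism `(x, a) ↦ (((x, a), a), idp a)`. -/
def idRefl : A.cpr ⟶ (mooreId R A).cpr :=
  idMk A.p (MPath.idp R A.q) (by
    rw [MPath.idp_fn, Category.assoc, pullback.condition])

@[simp] lemma idPath_idRefl : idPath (idRefl R A) = MPath.idp R A.q := idPath_idMk _ _ _

lemma idLeft_idRefl : idLeft (idRefl R A) = 𝟙 _ :=
  pullback.hom_ext (by rw [idRefl, Category.id_comp]; exact idLeft_idMk_p _ _ _) (by
    rw [← (idPath_src_tgt _).1, idPath_idRefl, Category.id_comp]; rfl)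

lemma toPath_comp_proj (P : MPath R X A.wk.cpr) (m : X ⟶ pathObj R A.proj)
    (h : m ≫ (mooreId R A).proj = P.src ≫ (mooreId R A).name) :
    (toPath m).fn ≫ A.proj = snd _ _ ≫ ((P.map A.wk.p).map A.p).src ≫ A.name := by
  rw [toPath_fiber, ((comp_mooreId_proj_eq_iff _ _).1 h).1]
  congr 1
  exact (liesOver_left A P).src_proj

variable [HasSubobjectClassifier C]

/-! ### The contraction path -/

lemma contr_cond (e : X ⟶ (mooreId R A).cpr) (t : Y ⟶ X) (j : Y ⟶ Pos R) :
    (((idPath e).restrict t).trunc j).fn ≫ A.proj =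
      snd _ _ ≫ (t ≫ idLeft e ≫ A.p) ≫ A.name := by
  rw [MPath.trunc_fn, MPath.restrict_ev, MPath.ev, Category.assoc, idPath_comp_proj]
  simp

lemma comp_contr {Z : C} (e : X ⟶ (mooreId R A).cpr) (r : Z ⟶ Y) (t : Y ⟶ X) (j : Y ⟶ Pos R) :
    r ≫ idMk (t ≫ idLeft e ≫ A.p) (((idPath e).restrict t).trunc j) (contr_cond e t j) =
      idMk ((r ≫ t) ≫ idLeft e ≫ A.p) (((idPath e).restrict (r ≫ t)).trunc (r ≫ j))
        (contr_cond e _ _) :=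
  id_hom_ext (by rw [idLeft_comp, Category.assoc, idLeft_idMk_p, idLeft_idMk_p, Category.assoc])
    (by rw [idPath_comp, idPath_idMk, idPath_idMk, MPath.trunc_restrict, MPath.restrict_restrict])

/-- The contraction path from `(((x, a₁), a₁), idp a₁)` to `(((x, a₁), a₂), p)`. -/
@[simps] def contr (e : X ⟶ (mooreId R A).cpr) : MPath R X (mooreId R A).cpr where
  src := idLeft e ≫ idRefl R A
  tgt := e
  fn := idMk (snd _ _ ≫ idLeft e ≫ A.p) (((idPath e).restrict (snd _ _)).trunc (fst _ _))
    (contr_cond e _ _)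
  shape := (idPath e).shape
  at_zero := by
    rw [comp_contr]
    refine id_hom_ext ?_ ?_
    · rw [idLeft_idMk_p, idLeft_comp, idLeft_idRefl, lift_snd, Category.id_comp,
        Category.comp_id]
    · rw [idPath_idMk, idPath_comp, idPath_idRefl, MPath.restrict_idp, lift_snd, lift_fst,
        Pos.zero_def, MPath.trunc_zero, MPath.restrict_id, (idPath_src_tgt e).1]
  at_ge {Y} t j h := by
    replace h : t ≫ (idPath e).shape ≤ j := by rw [Pos.le_def, Category.assoc]; exact h
    rw [comp_contr]
    refine id_hom_ext ?_ ?_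
    · rw [idLeft_idMk_p, idLeft_comp, lift_snd, Category.assoc]
    · rw [idPath_idMk, idPath_comp, lift_snd, lift_fst, MPath.trunc_of_le _ h]

lemma contr_ev (e : X ⟶ (mooreId R A).cpr) (t : Y ⟶ X) (j : Y ⟶ Pos R) :
    (contr e).ev t j =
      idMk (t ≫ idLeft e ≫ A.p) (((idPath e).restrict t).trunc j) (contr_cond e t j) := by
  rw [MPath.ev, contr_fn, comp_contr]
  congr 1
  · rw [lift_snd]
  · rw [lift_snd, lift_fst]

lemma idPath_contr_ev (e : X ⟶ (mooreId R A).cpr) (t : Y ⟶ X) (j : Y ⟶ Pos R) :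
    idPath ((contr e).ev t j) = ((idPath e).restrict t).trunc j := by
  rw [contr_ev, idPath_idMk]

lemma idLeft_contr_ev_p (e : X ⟶ (mooreId R A).cpr) (t : Y ⟶ X) (j : Y ⟶ Pos R) :
    idLeft ((contr e).ev t j) ≫ A.p = t ≫ idLeft e ≫ A.p := by
  rw [contr_ev, idLeft_idMk_p]

lemma isContraction_contr (e : X ⟶ (mooreId R A).cpr) : IsContraction e (contr e) where
  shape_eq := rfl
  left s i _ := by
    rw [MPath.lift_fn]
    refine pullback.hom_ext ?_ ?_
    · rw [Category.assoc]; exact idLeft_contr_ev_p e s i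
    · rw [← (idPath_src_tgt _).1, idPath_contr_ev, Category.assoc, ← (idPath_src_tgt e).1]
      rfl
  right s i _ := by
    rw [MPath.lift_fn, ← (idPath_src_tgt _).2, idPath_contr_ev, MPath.lift_fn, MPath.trunc_tgt,
      MPath.restrict_ev, Category.id_comp]
  path_shape s i h := by
    rw [MPath.lift_fn, idPath_contr_ev]
    refine inf_eq_left.2 ?_
    rw [Pos.le_def]; simpa using h
  path_fn s i _ _ r j hj := by
    rw [MPath.lift_fn, MPath.lift_fn, MPath.lift_fn, idPath_contr_ev, MPath.trunc_ev,
      MPath.restrict_ev, inf_eq_left.2]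
    rw [Pos.le_def]; simpa using hj

lemma contr_restrict (e : X ⟶ (mooreId R A).cpr) (t : Y ⟶ X) :
    (contr e).restrict t = contr (t ≫ e) :=
  MPath.ext_ev (by simp [idPath_comp]) (fun s j => by
    refine id_hom_ext ?_ ?_
    · rw [MPath.restrict_ev, idLeft_contr_ev_p, idLeft_contr_ev_p, idLeft_comp]
      simp
    · rw [MPath.restrict_ev, idPath_contr_ev, idPath_contr_ev, idPath_comp,
        MPath.restrict_restrict])

lemma contr_idRefl : contr (idRefl R A) = MPath.idp R (idRefl R A) :=
  MPath.ext_ev (by simp) (fun t j => by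
    refine id_hom_ext ?_ ?_
    · rw [idLeft_contr_ev_p, MPath.idp_ev, idLeft_comp, Category.assoc]
    · rw [idPath_contr_ev, MPath.idp_ev, idPath_comp, idPath_idRefl, MPath.trunc_of_le]
      rw [MPath.restrict_idp, MPath.idp_shape, Pos.zero_def]; exact zero_le)

/-! ### The transport structure on identity types -/

/-- The transport of the path `m` in a fibre of `A` along a path `P` in `Γ.A.A p`. -/
def idTr (s : Tap R A) (P : MPath R X A.wk.cpr) (m : X ⟶ pathObj R A.proj)
    (h : m ≫ (mooreId R A).proj = P.src ≫ (mooreId R A).name) : MPath R X A.tot :=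
  s.conj (liesOver_left A P) (liesOver_right P) (toPath m) (toPath_comp_proj P m h)
    ((comp_mooreId_proj_eq_iff _ _).1 h).1 ((comp_mooreId_proj_eq_iff _ _).1 h).2

lemma idTr_comp_proj (s : Tap R A) (P : MPath R X A.wk.cpr) (m : X ⟶ pathObj R A.proj)
    (h : m ≫ (mooreId R A).proj = P.src ≫ (mooreId R A).name) :
    (idTr s P m h).fn ≫ A.proj = snd _ _ ≫ (idTr s P m h).src ≫ A.proj := by
  have := s.conj_comp (liesOver_left A P) (liesOver_right P) (toPath m) (toPath_comp_proj P m h)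
    ((comp_mooreId_proj_eq_iff _ _).1 h).1 ((comp_mooreId_proj_eq_iff _ _).1 h).2
  exact this.trans (congrArg (fun z => snd _ _ ≫ z) (MPath.src_comp_of_fn_comp _ this).symm)

lemma idTr_restrict (s : Tap R A) (t : Y ⟶ X) (P : MPath R X A.wk.cpr) (m : X ⟶ pathObj R A.proj)
    (h : m ≫ (mooreId R A).proj = P.src ≫ (mooreId R A).name)
    (h' : (t ≫ m) ≫ (mooreId R A).proj = (P.restrict t).src ≫ (mooreId R A).name) :
    idTr s (P.restrict t) (t ≫ m) h' = (idTr s P m h).restrict t := by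
  have e := toPath_comp_proj (P.restrict t) (t ≫ m) h'
  rw [MPath.map_restrict, MPath.map_restrict, toPath_comp] at e
  refine Eq.trans ?_ (s.conj_restrict _ _ _ _ _ _ t e).symm
  refine s.conj_congr ?_ ?_ (MPath.map_restrict _ _ _) (toPath_comp _ _)
  · rw [MPath.map_restrict, MPath.map_restrict]
  · rw [MPath.map_restrict, MPath.map_restrict]

/-- The transport-along-paths structure on the family of objects of Moore paths in the fibres
of a fibration. -/
def mooreTap (s : Tap R A) : Tap R (mooreId R A) where
  tr P m h := ofPath (idTr s P m h) (idTr_comp_proj s P m h)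
  tr_proj P m h := (comp_mooreId_proj_eq_iff _ _).2 (by
    rw [toPath_ofPath]; exact ⟨rfl, rfl⟩)
  tr_restrict t P m h := toPath_injective (by
    refine (toPath_ofPath _ _).trans (Eq.trans (idTr_restrict s t P m h _) ?_)
    exact ((toPath_comp t _).trans (congrArg _ (toPath_ofPath _ _))).symm)
  tr_idp x m h := toPath_injective (by
    rw [toPath_ofPath]
    exact s.conj_of_idp _ _ _ _ _ _ (by rw [MPath.map_idp, MPath.map_idp]))

end

section

variable {C : Type u} [Category.{v} C] [CartesianMonoidalCategory C] [BraidedCategory C]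
  [HasFiniteLimits C] {R : C} [OrderedRingObj R] {Γ Δ : C}

/-- The `eqToHom` disappears, up to definitional equality, as soon as `B` and `A` are given by the same
morphism of `C`. -/
lemma fib_lift_comp_q (σ : Δ ⟶ Γ) {B : FibTy R Δ} {A : FibTy R Γ} (h : B = A.sub σ) :
    (Fib R).lift σ h ≫ A.fam.q = B.fam.q ≫ eqToHom (by rw [h]; rfl) :=
  pullback.lift_snd _ _ _

lemma FibTy.elVal_proj {A : FibTy R Γ} (a : (Fib R).El A) :
    FibTy.elVal a ≫ A.fam.proj = A.fam.name :=
  FamTm.valAs_proj _ _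

/-- An element of a fibration is determined by its underlying morphism. -/
lemma FibTy.mk_eq_of_elVal {A : FibTy R Γ} {a : FibTm R Γ} (h : a.ty = A) (b : Γ ⟶ A.fam.tot)
    (hb : b ≫ A.fam.proj = A.fam.name) (e : b = FibTy.elVal ⟨a, h⟩) :
    (⟨A, ⟨A.fam, b, hb⟩, rfl⟩ : FibTm R Γ) = a := by
  obtain ⟨ty, ⟨F, a, ha⟩, hf⟩ := a
  dsimp only at h hf
  subst h hf
  have e' : b = a := e.trans (Category.comp_id _)
  subst e'
  rfl

/-- The underlying morphism of a re-indexed element is obtained by composition. -/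
lemma FibTy.elVal_tmSub (σ : Δ ⟶ Γ) {A : FibTy R Γ} (a : (Fib R).El A)
    {A' : FibTy R Δ} (h : ((Fib R).tmSub σ a.1).ty = A') (hA : A'.fam.tot = A.fam.tot) :
    FibTy.elVal (A := A') ⟨(Fib R).tmSub σ a.1, h⟩ ≫ eqToHom hA = σ ≫ FibTy.elVal a := by
  obtain ⟨⟨ty, ⟨F, a, ha⟩, hf⟩, h'⟩ := a
  change ty = A at h'
  dsimp only at hf
  subst h' hf h
  exact (Category.comp_id _).trans
    ((Category.comp_id _).trans (congrArg (fun z => σ ≫ z) (Category.comp_id _).symm))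

/-! ### The morphisms between comprehension objects induced by re-indexing -/

/-- The morphism `Δ.Aγ ⟶ Γ.A` induced by `γ`. -/
def fibLift₁ (γ : Δ ⟶ Γ) (A : FibTy R Γ) : (A.fam.sub γ).cpr ⟶ A.fam.cpr :=
  (Fib R).lift₁ γ A

/-- The morphism `Δ.Aγ.Aγp ⟶ Γ.A.Ap` induced by `γ`. -/
def fibLift₂ (γ : Δ ⟶ Γ) (A : FibTy R Γ) : (A.fam.sub γ).wk.cpr ⟶ A.fam.wk.cpr :=
  (Fib R).lift₂ γ A

lemma fibLift₁_comp_p (γ : Δ ⟶ Γ) (A : FibTy R Γ) :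
    fibLift₁ γ A ≫ A.fam.p = (A.fam.sub γ).p ≫ γ :=
  (Fib R).lift_p γ rfl

lemma fibLift₁_comp_q (γ : Δ ⟶ Γ) (A : FibTy R Γ) :
    fibLift₁ γ A ≫ A.fam.q = (A.fam.sub γ).q :=
  (fib_lift_comp_q γ rfl).trans (Category.comp_id _)

lemma fibLift₂_comp_p (γ : Δ ⟶ Γ) (A : FibTy R Γ) :
    fibLift₂ γ A ≫ A.fam.wk.p = (A.fam.sub γ).wk.p ≫ fibLift₁ γ A :=
  (Fib R).lift_p _ ((Fib R).wk_tySub γ A)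

lemma fibLift₂_comp_q (γ : Δ ⟶ Γ) (A : FibTy R Γ) :
    fibLift₂ γ A ≫ A.fam.wk.q = (A.fam.sub γ).wk.q :=
  (fib_lift_comp_q _ ((Fib R).wk_tySub γ A)).trans (Category.comp_id _)

lemma fibLift₂_comp_p_p (γ : Δ ⟶ Γ) (A : FibTy R Γ) :
    fibLift₂ γ A ≫ A.fam.wk.p ≫ A.fam.p = (A.fam.sub γ).wk.p ≫ (A.fam.sub γ).p ≫ γ := by
  rw [← Category.assoc, fibLift₂_comp_p, Category.assoc, fibLift₁_comp_p]

lemma fibLift₂_comp_p_q (γ : Δ ⟶ Γ) (A : FibTy R Γ) :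
    fibLift₂ γ A ≫ A.fam.wk.p ≫ A.fam.q = (A.fam.sub γ).wk.p ≫ (A.fam.sub γ).q := by
  rw [← Category.assoc, fibLift₂_comp_p, Category.assoc, fibLift₁_comp_q]
  rfl

variable [MonoidalClosed C]

lemma idRefl_p (A : FibTy R Γ) : idRefl R A.fam ≫ (mooreId R A.fam).p = (Fib R).diag A := by
  refine pullback.hom_ext ?_ ?_
  · exact idLeft_idRefl.trans ((Fib R).pair_p _ _ _).symm
  · have h := (idPath_src_tgt (idRefl R A.fam)).2
    rw [idPath_idRefl] at h
    refine h.symm.trans ?_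
    exact ((pullback.lift_snd _ _ _).trans (Category.comp_id _)).symm

lemma elVal_proj_idRefl {A : FibTy R Γ} {B : FibTy R (mooreId R A.fam).cpr}
    (β : (Fib R).El (B.sub (idRefl R A.fam))) :
    (FibTy.elVal β : A.fam.cpr ⟶ B.fam.tot) ≫ B.fam.proj = idRefl R A.fam ≫ B.fam.name :=
  FibTy.elVal_proj β

variable [HasSubobjectClassifier C]

/-! ### Stability of the identity types under re-indexing -/

/-- Transport of paths is stable under re-indexing: `L` stands for the morphism
`Δ.Aγ.Aγp ⟶ Γ.A.Ap` induced by `γ`. -/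
lemma idTr_sub {A : Fam Γ} (s : Tap R A) (γ : Δ ⟶ Γ) (L : (A.sub γ).wk.cpr ⟶ A.wk.cpr)
    (h₁ : L ≫ A.wk.p ≫ A.p = (A.sub γ).wk.p ≫ (A.sub γ).p ≫ γ)
    (h₂ : L ≫ A.wk.p ≫ A.q = (A.sub γ).wk.p ≫ (A.sub γ).q) (h₃ : L ≫ A.wk.q = (A.sub γ).wk.q)
    {X : C} (P : MPath R X (A.sub γ).wk.cpr) (m : X ⟶ pathObj R A.proj)
    (h : m ≫ (mooreId R (A.sub γ)).proj = P.src ≫ (mooreId R (A.sub γ)).name)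
    (h' : m ≫ (mooreId R A).proj = (P.map L).src ≫ (mooreId R A).name) :
    idTr (s.sub γ) P m h = idTr s (P.map L) m h' := by
  have e₁ : ((P.map (A.sub γ).wk.p).map (A.sub γ).p).map γ = ((P.map L).map A.wk.p).map A.p := by
    simp only [← MPath.map_comp, h₁, Category.assoc]
  have e₂ : (P.map (A.sub γ).wk.p).map (A.sub γ).q = ((P.map L).map A.wk.p).map A.q := by
    refine (MPath.map_comp _ _ _).symm.trans (Eq.trans ?_
      ((MPath.map_comp _ _ _).trans (MPath.map_comp _ _ _)))
    exact congrArg (fun z => P.map z) h₂.symm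
  have e₃ : P.map (A.sub γ).wk.q = (P.map L).map A.wk.q :=
    (congrArg (fun z => P.map z) h₃.symm).trans (MPath.map_comp _ _ _)
  refine (Tap.conj_sub s γ _ _ _ _ _ _ ?_).trans (Tap.conj_congr s e₁ e₂ e₃ rfl)
  rw [e₁]
  exact toPath_comp_proj _ _ h'

/-- The identity type of a fibration `A` over `Γ`, as a fibration over `Γ.A.A p`. -/
abbrev fibId (Γ : C) (A : FibTy R Γ) : FibTy R A.fam.wk.cpr :=
  ⟨mooreId R A.fam, mooreTap A.tap⟩

lemma fibId_sub (γ : Δ ⟶ Γ) (A : FibTy R Γ) :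
    fibId Δ (A.sub γ) = (fibId Γ A).sub (fibLift₂ γ A) := by
  refine FibTy.ext_of (V := pullback A.fam.proj A.fam.proj) (E := pathObj R A.fam.proj)
    (π := (mooreId R A.fam).proj) ?_ _ _ ?_
  · refine pullback.hom_ext ?_ ?_
    · refine (pullback.lift_fst _ _ _).trans ((fibLift₂_comp_p_q γ A).symm.trans ?_)
      exact (congrArg (fun z => fibLift₂ γ A ≫ z) (pullback.lift_fst _ _ _).symm).trans
        (Category.assoc _ _ _).symm
    · refine (pullback.lift_snd _ _ _).trans ((fibLift₂_comp_q γ A).symm.trans ?_)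
      exact (congrArg (fun z => fibLift₂ γ A ≫ z) (pullback.lift_snd _ _ _).symm).trans
        (Category.assoc _ _ _).symm
  · intro X p a h₁ h₂
    have h₂' : a ≫ (mooreId R A.fam).proj =
        (p.map (fibLift₂ γ A)).src ≫ (mooreId R A.fam).name :=
      h₂.trans (Category.assoc _ _ _).symm
    refine toPath_injective ((toPath_ofPath _ (idTr_comp_proj (A.tap.sub γ) p a h₁)).trans
      (Eq.trans ?_ (toPath_ofPath _ (idTr_comp_proj A.tap _ a h₂')).symm))
    exact idTr_sub A.tap γ _ (fibLift₂_comp_p_p γ A) (fibLift₂_comp_p_q γ A)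
      (fibLift₂_comp_q γ A) p a _ _

/-- The morphism `Δ.Aγ.Aγp.Id ⟶ Γ.A.Ap.Id` induced by `γ`. -/
def fibLift₃ (γ : Δ ⟶ Γ) (A : FibTy R Γ) :
    (mooreId R (A.fam.sub γ)).cpr ⟶ (mooreId R A.fam).cpr :=
  (Fib R).lift (fibLift₂ γ A) (fibId_sub γ A)

section

variable (γ : Δ ⟶ Γ) (A : FibTy R Γ) {X : C} (e : X ⟶ (mooreId R (A.fam.sub γ)).cpr)

lemma idLeft_comp_fibLift₃ : idLeft (e ≫ fibLift₃ γ A) = idLeft e ≫ fibLift₁ γ A := by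
  have h : fibLift₃ γ A ≫ (mooreId R A.fam).p = (mooreId R (A.fam.sub γ)).p ≫ fibLift₂ γ A :=
    (Fib R).lift_p _ _
  rw [idLeft, idLeft, Category.assoc e, h, Category.assoc, Category.assoc, fibLift₂_comp_p]
  simp only [Category.assoc]

lemma idLeft_comp_fibLift₃_p :
    idLeft (e ≫ fibLift₃ γ A) ≫ A.fam.p = (idLeft e ≫ (A.fam.sub γ).p) ≫ γ := by
  rw [idLeft_comp_fibLift₃, Category.assoc, fibLift₁_comp_p, Category.assoc]

lemma idPath_comp_fibLift₃ : idPath (e ≫ fibLift₃ γ A) = idPath e := by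
  have h : fibLift₃ γ A ≫ (mooreId R A.fam).q = (mooreId R (A.fam.sub γ)).q :=
    (fib_lift_comp_q _ (fibId_sub γ A)).trans (Category.comp_id _)
  exact congrArg toPath ((Category.assoc _ _ _).trans (congrArg (fun z => e ≫ z) h))

lemma idRefl_comp_fibLift₃ :
    idRefl R (A.fam.sub γ) ≫ fibLift₃ γ A = fibLift₁ γ A ≫ idRefl R A.fam := by
  refine id_hom_ext ?_ ?_
  · rw [idLeft_comp_fibLift₃_p, idLeft_idRefl, idLeft_comp, idLeft_idRefl, Category.id_comp,
      Category.comp_id, fibLift₁_comp_p]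
  · refine (idPath_comp_fibLift₃ γ A _).trans (idPath_idRefl.trans ?_)
    rw [idPath_comp, idPath_idRefl, MPath.restrict_idp, fibLift₁_comp_q]
    rfl

lemma contr_map_fibLift₃ : (contr e).map (fibLift₃ γ A) = contr (e ≫ fibLift₃ γ A) := by
  refine MPath.ext_ev (congrArg MPath.shape (idPath_comp_fibLift₃ γ A e)).symm (fun t j => ?_)
  rw [MPath.map_ev]
  refine id_hom_ext ?_ ?_
  · rw [idLeft_comp_fibLift₃_p, idLeft_contr_ev_p, idLeft_contr_ev_p, idLeft_comp_fibLift₃_p]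
    simp only [Category.assoc]
  · refine (idPath_comp_fibLift₃ γ A ((contr e).ev t j)).trans ((idPath_contr_ev e t j).trans ?_)
    refine Eq.trans ?_ (idPath_contr_ev (e ≫ fibLift₃ γ A) t j).symm
    exact congrArg (fun p => (MPath.restrict t p).trunc j) (idPath_comp_fibLift₃ γ A e).symm

end

/-! ### The eliminator -/

section Elim

variable {A : Fam Γ} {B : Fam (mooreId R A).cpr} (s : Tap R B) (b : A.cpr ⟶ B.tot)
  (hb : b ≫ B.proj = idRefl R A ≫ B.name) {X : C}

lemma elim_cond (b : A.cpr ⟶ B.tot) (hb : b ≫ B.proj = idRefl R A ≫ B.name) (e : X ⟶ (mooreId R A).cpr) :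
    (idLeft e ≫ b) ≫ B.proj = (contr e).src ≫ B.name := by
  rw [contr_src, Category.assoc, Category.assoc, hb]

/-- The eliminator `J`: transport of `b` along the contraction path of the generic element. -/
def elim : (mooreId R A).cpr ⟶ B.tot :=
  s.tr (contr (𝟙 _)) (idLeft (𝟙 _) ≫ b) (elim_cond b hb _)

lemma elim_proj : elim s b hb ≫ B.proj = B.name := by
  rw [elim, s.tr_proj, contr_tgt, Category.id_comp]

/-- Since transport is natural in the stage, the value of the eliminator at `e` is transport along the
contraction path of `e`. -/
lemma comp_elim (e : X ⟶ (mooreId R A).cpr) :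
    e ≫ elim s b hb = s.tr (contr e) (idLeft e ≫ b) (elim_cond b hb e) := by
  rw [elim, ← s.tr_restrict]
  refine s.tr_congr ?_ ?_ _
  · rw [contr_restrict, Category.comp_id]
  · rw [← Category.assoc, ← idLeft_comp, Category.comp_id]

lemma idRefl_comp_elim : idRefl R A ≫ elim s b hb = b := by
  rw [comp_elim]
  refine (s.tr_congr (a' := b) contr_idRefl ?_ _).trans (s.tr_idp _ _ _)
  rw [idLeft_idRefl, Category.id_comp]

end Elim

lemma elim_sub (γ : Δ ⟶ Γ) (A : FibTy R Γ) {B : Fam (mooreId R A.fam).cpr} (s : Tap R B)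
    (b : A.fam.cpr ⟶ B.tot) (hb : b ≫ B.proj = idRefl R A.fam ≫ B.name)
    (b' : (A.fam.sub γ).cpr ⟶ B.tot) (h : b' = fibLift₁ γ A ≫ b)
    (hb' : b' ≫ B.proj = idRefl R (A.fam.sub γ) ≫ fibLift₃ γ A ≫ B.name) :
    elim (s.sub (fibLift₃ γ A)) b' hb' = fibLift₃ γ A ≫ elim s b hb := by
  subst h
  rw [comp_elim]
  refine s.tr_congr ?_ ?_ _
  · rw [contr_map_fibLift₃, Category.id_comp]
  · have h := idLeft_comp_fibLift₃ γ A (𝟙 _)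
    rw [Category.id_comp] at h
    rw [h]
    exact (Category.assoc _ _ _).symm

variable (R) in
/-- The intensional identity types given by Moore path objects. -/
def mooreIdTypes : (Fib R).IdTypes (mooreIdFib fun _ A => mooreTap A.tap) where
  Id_sub γ A := fibId_sub γ A
  refl A := idRefl R A.fam
  refl_p A := idRefl_p A
  refl_sub γ A := idRefl_comp_fibLift₃ γ A
  J A B β := ⟨⟨B, ⟨B.fam, elim B.tap (FibTy.elVal β) (elVal_proj_idRefl (A := A) (B := B) β),
    elim_proj _ _ _⟩, rfl⟩, rfl⟩
  J_refl A B β := FibTy.mk_eq_of_elVal β.2 _ _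
    (idRefl_comp_elim B.tap (FibTy.elVal β) (elVal_proj_idRefl (A := A) (B := B) β))
  J_sub {Δ Γ} γ A B β := by
    refine FibTm.ext rfl (FamTm.ext_of rfl ?_ _ _)
    exact elim_sub γ A B.tap _ (elVal_proj_idRefl (A := A) (B := B) β) _
      ((Category.comp_id _).symm.trans (FibTy.elVal_tmSub (fibLift₁ γ A) β _ rfl)) _

end

end

end MooreTT

open MooreTT
theorem theorem4p8 {C : Type u} [Category.{v} C] [CartesianMonoidalCategory C]
    [BraidedCategory C] [HasFiniteLimits C] [MonoidalClosed C] [HasSubobjectClassifier C]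
    (R : C) [OrderedRingObj R] :
    ∃ (t : ∀ (Γ : C) (A : FibTy R Γ), Tap R (mooreId R A.fam))
      (S : (Fib R).IdTypes (mooreIdFib t)),
      (∀ {Γ : C} (A : FibTy R Γ),
        idPath (S.refl A) = MPath.idp R (A.fam.q)) ∧
      (∀ {Γ : C} (A : FibTy R Γ) (B : (Fib R).Ty ((Fib R).ext (mooreIdFib t Γ A)))
        (β : (Fib R).El ((Fib R).tySub (S.refl A) B))
        {X : C} (e : X ⟶ (mooreId R A.fam).cpr),
        ∃ (c : MPath R X (mooreId R A.fam).cpr)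
          (h : (idLeft e ≫ FibTy.elVal β) ≫ (FibTy.fam B).proj = c.src ≫ (FibTy.fam B).name),
          IsContraction e c ∧ c.src = idLeft e ≫ S.refl A ∧ c.tgt = e ∧
          e ≫ FibTy.elVal (S.J A B β) = (FibTy.tap B).tr c (idLeft e ≫ FibTy.elVal β) h) := by
  refine ⟨fun _ A => mooreTap A.tap, mooreIdTypes R, fun A => idPath_idRefl, ?_⟩
  intro Γ A B β X e
  have hβ := elVal_proj_idRefl (A := A) (B := B) β
  exact ⟨contr e, elim_cond _ hβ e, isContraction_contr e, rfl, rfl,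
    (congrArg (fun z => e ≫ z) (Category.comp_id _)).trans
      (comp_elim (FibTy.tap B) (FibTy.elVal β) hβ e)⟩
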